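/- Let $p\ge 1$, $\alpha,\beta>-1$, let $\ell\ge 1$ be an integer and $\varpi=(\omega_0,\dots,\omega_{\ell-1})\in\mathbb{R}^{\ell}$. Put $d\mu(x)=(1-x)^{\alpha}(1+x)^{\beta}\,dx$ on $[-1,1]$ and $$\|f\|=\Big(\sum_{k=0}^{\ell-1}|f^{(k)}(\omega_k)|^p+\int_{-1}^{1}|f^{(\ell)}(x)|^p\,d\mu(x)\Big)^{1/p}.$$ This is a seminorm on the linear space of all functions $f:\mathbb{R}\to\mathbb{R}$ such that (1) $f$ has a derivative of order $k$ at $\omega_k$ for $k=1,\dots,\ell-1$; (2) $f$ is $\ell-1$ times differentiable on $(-1,1)$ and $f^{(\ell-1)}$ is absolutely continuous on every compact subset of $(-1,1)$; (3) $f^{(\ell)}\in L^p(\mu)$. Let $\mathbf{U}$ be the normed space of the equivalence classes of such functions under $f\sim g\iff\|f-g\|=0$, and let $\mathbf{W}$ be the completion of the space $\mathbb{P}$ of real polynomials under $\|\cdot\|$. **Theorem.** $\mathbf{U}$ is complete if and only if one of the following holds: - $\ell=1$; - $\ell\ge2$, $p>1$ and, for every $m=1,\dots,\ell-1$: $\omega_{\ell-m}\ne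 1$ if $\alpha\ge mp-1$, and $\omega_{\ell-m}\neq-1$ if $\beta\ge mp-1$; - $\ell\ge2$, $p=1$ and, for every $m=1,\dots,\ell-1$: $\omega_{\ell-m}\ne 1$ if $\alpha> m-1$, and $\omega_{\ell-m}\neq-1$ if $\beta> m-1$. Moreover, if $\mathbf{U}$ is complete then $\mathbf{U}=\mathbf{W}$, that is, there is a linear isometric bijection of $\mathbf{U}$ onto $\mathbf{W}$ that carries the class of each polynomial to its image in the completion. -/

import Mathlib

open MeasureTheory Set Filter Topology

noncomputable section

namespace JacobiSobolev

/-- `HasDerivOfOrder f k x`: the function `f : ℝ → ℝ` has a derivative of order `k` at `x`,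
i.e. it has one of order `k - 1` at all points near `x` and `f^(k-1)` is differentiable at `x`
(no condition for `k = 0`).  Its value is then `iteratedDeriv k f x`. -/
def HasDerivOfOrder (f : ℝ → ℝ) : ℕ → ℝ → Prop
  | 0, _ => True
  | k + 1, x => (∀ᶠ y in 𝓝 x, HasDerivOfOrder f k y) ∧ DifferentiableAt ℝ (iteratedDeriv k f) x

/-- The Jacobi measure `(1 - x)^α (1 + x)^β dx` on `[-1, 1]`. -/
def jacobiMeasure (α β : ℝ) : Measure ℝ :=
  (volume.restrict (Icc (-1) 1)).withDensity
    (fun x => ENNReal.ofReal ((1 - x) ^ α * (1 + x) ^ β))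

/-- The functions with finite discrete-continuous Jacobi–Sobolev seminorm.  Every compact subset
of `(-1, 1)` lies in a compact interval `[a, b] ⊆ (-1, 1)`, so absolute continuity on compact
subsets is absolute continuity on those intervals. -/
structure IsSobolev (p α β : ℝ) {ℓ : ℕ} (ω : Fin ℓ → ℝ) (f : ℝ → ℝ) : Prop where
  deriv_at : ∀ k : Fin ℓ, HasDerivOfOrder f k (ω k)
  deriv_on : ∀ x ∈ Ioo (-1 : ℝ) 1, HasDerivOfOrder f (ℓ - 1) x
  absCont : ∀ a b : ℝ, -1 < a → a ≤ b → b < 1 →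
    AbsolutelyContinuousOnInterval (iteratedDeriv (ℓ - 1) f) a b
  memLp : MemLp (iteratedDeriv ℓ f) (ENNReal.ofReal p) (jacobiMeasure α β)

/-- The Jacobi–Sobolev seminorm
`(∑_{k<ℓ} |f^(k)(ω_k)|^p + ∫_{-1}^{1} |f^(ℓ)|^p dμ)^(1/p)`. -/
def sobolevNorm (p α β : ℝ) {ℓ : ℕ} (ω : Fin ℓ → ℝ) (f : ℝ → ℝ) : ℝ :=
  (∑ k : Fin ℓ, |iteratedDeriv k f (ω k)| ^ p
    + ∫ x, |iteratedDeriv ℓ f x| ^ p ∂(jacobiMeasure α β)) ^ (1 / p)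

/-! ### Linearity of the derivatives -/

theorem HasDerivOfOrder.comb {f g : ℝ → ℝ} (a b : ℝ) : ∀ {k : ℕ} {x : ℝ},
    HasDerivOfOrder f k x → HasDerivOfOrder g k x →
    HasDerivOfOrder (a • f + b • g) k x ∧
      iteratedDeriv k (a • f + b • g) x = a * iteratedDeriv k f x + b * iteratedDeriv k g x := by
  intro k
  induction k with
  | zero => intro x _ _; exact ⟨trivial, by simp⟩
  | succ k ih =>
    intro x hf hg
    have hev : iteratedDeriv k (a • f + b • g) =ᶠ[𝓝 x]
        fun y => a * iteratedDeriv k f y + b * iteratedDeriv k g y := by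
      filter_upwards [hf.1, hg.1] with y h1 h2 using (ih h1 h2).2
    have hd : HasDerivAt (fun y => a * iteratedDeriv k f y + b * iteratedDeriv k g y)
        (a * deriv (iteratedDeriv k f) x + b * deriv (iteratedDeriv k g) x) x :=
      (hf.2.hasDerivAt.const_mul a).add (hg.2.hasDerivAt.const_mul b)
    refine ⟨⟨?_, ?_⟩, ?_⟩
    · filter_upwards [hf.1, hg.1] with y h1 h2 using (ih h1 h2).1
    · exact hev.differentiableAt_iff.2 hd.differentiableAt
    · rw [iteratedDeriv_succ, iteratedDeriv_succ, iteratedDeriv_succ, hev.deriv_eq, hd.deriv]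

theorem ae_jacobi_of_ae {α β : ℝ} {q : ℝ → Prop}
    (h : ∀ᵐ x ∂volume, x ∈ Ioo (-1 : ℝ) 1 → q x) : ∀ᵐ x ∂(jacobiMeasure α β), q x := by
  have hac : jacobiMeasure α β ≪ volume.restrict (Icc (-1) 1) :=
    withDensity_absolutelyContinuous _ _
  refine hac.ae_le ?_
  rw [Measure.restrict_congr_set (Ioo_ae_eq_Icc (μ := volume) (a := (-1 : ℝ)) (b := 1)).symm]
  exact (ae_restrict_iff' measurableSet_Ioo).2 h

variable {p α β : ℝ} {ℓ : ℕ} {ω : Fin ℓ → ℝ}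

theorem IsSobolev.ae_differentiableAt {f : ℝ → ℝ} (hf : IsSobolev p α β ω f) :
    ∀ᵐ x ∂volume, x ∈ Ioo (-1 : ℝ) 1 → DifferentiableAt ℝ (iteratedDeriv (ℓ - 1) f) x := by
  obtain ⟨u, _, hu1, hu⟩ := exists_seq_strictMono_tendsto' (show (0 : ℝ) < 1 by norm_num)
  have key : ∀ n, ∀ᵐ x ∂volume, x ∈ uIcc (-(u n)) (u n) →
      DifferentiableAt ℝ (iteratedDeriv (ℓ - 1) f) x := fun n =>
    (hf.absCont (-(u n)) (u n) (by linarith [(hu1 n).2]) (by linarith [(hu1 n).1])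
      (hu1 n).2).ae_differentiableAt
  filter_upwards [ae_all_iff.2 key] with x hx hx1
  obtain ⟨n, hn⟩ := (hu.eventually (lt_mem_nhds (abs_lt.2 hx1))).exists
  apply hx n
  rw [uIcc_of_le (by linarith [(hu1 n).1])]
  exact ⟨(abs_lt.1 hn).1.le, (abs_lt.1 hn).2.le⟩

theorem IsSobolev.ae_comb {f g : ℝ → ℝ} (hf : IsSobolev p α β ω f) (hg : IsSobolev p α β ω g)
    (a b : ℝ) : iteratedDeriv ℓ (a • f + b • g) =ᵐ[jacobiMeasure α β]
      a • iteratedDeriv ℓ f + b • iteratedDeriv ℓ g := by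
  apply ae_jacobi_of_ae
  filter_upwards [hf.ae_differentiableAt, hg.ae_differentiableAt] with x h1 h2 hx
  rcases Nat.eq_zero_or_pos ℓ with h0 | h0
  · subst h0; simp
  · obtain ⟨n, rfl⟩ : ∃ n, ℓ = n + 1 := ⟨ℓ - 1, by omega⟩
    have hn : ∀ᶠ y in 𝓝 x, y ∈ Ioo (-1 : ℝ) 1 := Ioo_mem_nhds hx.1 hx.2
    have hF : HasDerivOfOrder f (n + 1) x :=
      ⟨by filter_upwards [hn] with y hy using hf.deriv_on y hy, h1 hx⟩
    have hG : HasDerivOfOrder g (n + 1) x :=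
      ⟨by filter_upwards [hn] with y hy using hg.deriv_on y hy, h2 hx⟩
    simpa using (hF.comb a b hG).2

theorem IsSobolev.comb {f g : ℝ → ℝ} (hf : IsSobolev p α β ω f) (hg : IsSobolev p α β ω g)
    (a b : ℝ) : IsSobolev p α β ω (a • f + b • g) where
  deriv_at k := ((hf.deriv_at k).comb a b (hg.deriv_at k)).1
  deriv_on x hx := ((hf.deriv_on x hx).comb a b (hg.deriv_on x hx)).1
  absCont s t hs hst ht := by
    have h := ((hf.absCont s t hs hst ht).const_mul a).add ((hg.absCont s t hs hst ht).const_mul b)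
    have heq : ∀ x ∈ uIcc s t, iteratedDeriv (ℓ - 1) (a • f + b • g) x =
        a * iteratedDeriv (ℓ - 1) f x + b * iteratedDeriv (ℓ - 1) g x := by
      intro x hx
      rw [uIcc_of_le hst] at hx
      have hx' : x ∈ Ioo (-1 : ℝ) 1 := ⟨hs.trans_le hx.1, hx.2.trans_lt ht⟩
      exact ((hf.deriv_on x hx').comb a b (hg.deriv_on x hx')).2
    rw [absolutelyContinuousOnInterval_iff] at h ⊢
    intro ε hε
    obtain ⟨δ, hδ, h⟩ := h ε hε
    refine ⟨δ, hδ, fun E hE hl => ?_⟩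
    refine lt_of_le_of_lt (le_of_eq ?_) (h E hE hl)
    refine Finset.sum_congr rfl fun i hi => ?_
    rw [heq _ (hE.1 i hi).1, heq _ (hE.1 i hi).2]
    rfl
  memLp := (memLp_congr_ae (hf.ae_comb hg a b)).2
    ((hf.memLp.const_smul a).add (hg.memLp.const_smul b))

theorem _root_.ContDiff.hasDerivOfOrder {f : ℝ → ℝ} (hf : ContDiff ℝ (⊤ : ℕ∞) f) :
    ∀ (k : ℕ) (x : ℝ), HasDerivOfOrder f k x
  | 0, _ => trivial
  | k + 1, x => ⟨Eventually.of_forall fun y => hf.hasDerivOfOrder k y,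
      (hf.differentiable_iteratedDeriv k (by exact_mod_cast WithTop.coe_lt_top k)) x⟩

instance isFiniteMeasure_jacobi (α β : ℝ) [hα : Fact (-1 < α)] [hβ : Fact (-1 < β)] :
    IsFiniteMeasure (jacobiMeasure α β) := by
  have h1 : IntervalIntegrable (fun x : ℝ => (1 - x) ^ α * (1 + x) ^ β) volume (-1) 0 := by
    have h : IntervalIntegrable (fun x : ℝ => (1 + x) ^ β) volume (-1) 0 := by
      have := (intervalIntegral.intervalIntegrable_rpow' (a := 0) (b := 1) hβ.out).comp_add_left 1
      simpa using this
    apply h.continuousOn_mul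
    intro x hx
    rw [uIcc_of_le (by norm_num)] at hx
    exact (ContinuousAt.rpow_const (by fun_prop) (Or.inl (by linarith [hx.2]))).continuousWithinAt
  have h2 : IntervalIntegrable (fun x : ℝ => (1 - x) ^ α * (1 + x) ^ β) volume 0 1 := by
    have h : IntervalIntegrable (fun x : ℝ => (1 - x) ^ α) volume 0 1 := by
      have := (intervalIntegral.intervalIntegrable_rpow' (a := 0) (b := 1) hα.out).comp_sub_left 1
      simpa using this.symm
    apply h.mul_continuousOn
    intro x hx
    rw [uIcc_of_le (by norm_num)] at hx
    exact (ContinuousAt.rpow_const (by fun_prop) (Or.inl (by linarith [hx.1]))).continuousWithinAt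
  have h3 := (intervalIntegrable_iff_integrableOn_Icc_of_le (by norm_num)).1 (h1.trans h2)
  exact isFiniteMeasure_withDensity_ofReal h3.2

theorem contDiff_polynomial (P : Polynomial ℝ) :
    ContDiff ℝ (⊤ : ℕ∞) (fun x => P.eval x) := by
  simpa using P.contDiff_aeval (𝕜 := ℝ) (⊤ : ℕ∞)

theorem isSobolev_polynomial [Fact (-1 < α)] [Fact (-1 < β)] (P : Polynomial ℝ) :
    IsSobolev p α β ω (fun x => P.eval x) where
  deriv_at k := (contDiff_polynomial P).hasDerivOfOrder k _
  deriv_on x _ := (contDiff_polynomial P).hasDerivOfOrder _ x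
  absCont a b _ _ _ := by
    refine ContDiffOn.absolutelyContinuousOnInterval (ContDiff.contDiffOn ?_)
    rw [iteratedDeriv_eq_iterate]
    exact ContDiff.iterate_deriv' 1 (ℓ - 1) (contDiff_infty.1 (contDiff_polynomial P) _)
  memLp := by
    have hc : Continuous (iteratedDeriv ℓ (fun x => P.eval x)) :=
      (contDiff_polynomial P).continuous_iteratedDeriv ℓ
        (by exact_mod_cast le_top)
    obtain ⟨C, hC⟩ := (isCompact_Icc (a := (-1 : ℝ)) (b := 1)).exists_bound_of_continuousOn
      hc.continuousOn
    refine MemLp.of_bound hc.aestronglyMeasurable C (ae_jacobi_of_ae ?_)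
    exact Eventually.of_forall fun x hx => hC x (Ioo_subset_Icc_self hx)

/-! ### Minkowski's inequality and homogeneity -/

theorem integral_nonneg_jacobi (f : ℝ → ℝ) :
    0 ≤ ∫ x, |iteratedDeriv ℓ f x| ^ p ∂(jacobiMeasure α β) :=
  integral_nonneg fun _ => by positivity

theorem integral_eq_eLpNorm (hp : 1 ≤ p) {g : ℝ → ℝ}
    (hg : MemLp g (ENNReal.ofReal p) (jacobiMeasure α β)) :
    ∫ x, |g x| ^ p ∂(jacobiMeasure α β)
      = |(eLpNorm g (ENNReal.ofReal p) (jacobiMeasure α β)).toReal| ^ p := by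
  have hp0 : 0 < p := by linarith
  have h0 : 0 ≤ ∫ x, |g x| ^ p ∂(jacobiMeasure α β) := integral_nonneg fun _ => by positivity
  rw [abs_of_nonneg ENNReal.toReal_nonneg,
    hg.eLpNorm_eq_integral_rpow_norm (by simpa using hp0) ENNReal.ofReal_ne_top,
    ENNReal.toReal_ofReal hp0.le, ENNReal.toReal_ofReal (by positivity)]
  simp only [Real.norm_eq_abs]
  rw [Real.rpow_inv_rpow h0 hp0.ne']

theorem sobolevNorm_add_le (hp : 1 ≤ p) {f g : ℝ → ℝ} (hf : IsSobolev p α β ω f)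
    (hg : IsSobolev p α β ω g) :
    sobolevNorm p α β ω (f + g) ≤ sobolevNorm p α β ω f + sobolevNorm p α β ω g := by
  have hp0 : 0 < p := by linarith
  have hfg : IsSobolev p α β ω (f + g) := by simpa using hf.comb hg 1 1
  have hae : iteratedDeriv ℓ (f + g) =ᵐ[jacobiMeasure α β]
      iteratedDeriv ℓ f + iteratedDeriv ℓ g := by simpa using hf.ae_comb hg 1 1
  have hpt : ∀ k : Fin ℓ, iteratedDeriv k (f + g) (ω k)
      = iteratedDeriv k f (ω k) + iteratedDeriv k g (ω k) := fun k => by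
    simpa using ((hf.deriv_at k).comb 1 1 (hg.deriv_at k)).2
  set N : (ℝ → ℝ) → ℝ := fun h =>
    (eLpNorm (iteratedDeriv ℓ h) (ENNReal.ofReal p) (jacobiMeasure α β)).toReal with hN
  let v : (ℝ → ℝ) → Option (Fin ℓ) → ℝ := fun h o => o.elim (N h) fun k => iteratedDeriv k h (ω k)
  have hv : ∀ h, IsSobolev p α β ω h →
      sobolevNorm p α β ω h = (∑ o, |v h o| ^ p) ^ (1 / p) := by
    intro h hh
    rw [sobolevNorm, integral_eq_eLpNorm hp hh.memLp, Fintype.sum_option, add_comm]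
    rfl
  rw [hv _ hfg, hv _ hf, hv _ hg]
  refine le_trans ?_ (Real.Lp_add_le Finset.univ (v f) (v g) hp)
  refine Real.rpow_le_rpow (by positivity) (Finset.sum_le_sum fun o _ => ?_) (by positivity)
  refine Real.rpow_le_rpow (abs_nonneg _) ?_ hp0.le
  rcases o with _ | k
  · have h1 : N (f + g) ≤ N f + N g := by
      simp only [hN]
      rw [eLpNorm_congr_ae hae, ← ENNReal.toReal_add hf.memLp.2.ne hg.memLp.2.ne]
      refine ENNReal.toReal_mono (ENNReal.add_ne_top.2 ⟨hf.memLp.2.ne, hg.memLp.2.ne⟩) ?_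
      exact eLpNorm_add_le hf.memLp.1 hg.memLp.1 (by simpa using hp)
    change |N (f + g)| ≤ |N f + N g|
    have h0 : ∀ h, 0 ≤ N h := fun h => ENNReal.toReal_nonneg
    rw [abs_of_nonneg (h0 _), abs_of_nonneg (add_nonneg (h0 _) (h0 _))]
    exact h1
  · exact le_of_eq (congrArg _ (hpt k))

theorem sobolevNorm_smul (hp : 1 ≤ p) (a : ℝ) {f : ℝ → ℝ} (hf : IsSobolev p α β ω f) :
    sobolevNorm p α β ω (a • f) = |a| * sobolevNorm p α β ω f := by
  have hp0 : 0 < p := by linarith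
  have hae : iteratedDeriv ℓ (a • f) =ᵐ[jacobiMeasure α β] a • iteratedDeriv ℓ f := by
    simpa using hf.ae_comb hf a 0
  have hpt : ∀ k : Fin ℓ, iteratedDeriv k (a • f) (ω k) = a * iteratedDeriv k f (ω k) := fun k => by
    simpa using ((hf.deriv_at k).comb a 0 (hf.deriv_at k)).2
  have hint : ∫ x, |iteratedDeriv ℓ (a • f) x| ^ p ∂(jacobiMeasure α β)
      = |a| ^ p * ∫ x, |iteratedDeriv ℓ f x| ^ p ∂(jacobiMeasure α β) := by
    rw [← integral_const_mul]
    refine integral_congr_ae ?_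
    filter_upwards [hae] with x hx
    rw [hx, Pi.smul_apply, smul_eq_mul, abs_mul, Real.mul_rpow (abs_nonneg _) (abs_nonneg _)]
  have h0 := integral_nonneg_jacobi (p := p) (α := α) (β := β) (ℓ := ℓ) f
  rw [sobolevNorm, sobolevNorm, hint]
  simp only [hpt, abs_mul, Real.mul_rpow (abs_nonneg _) (abs_nonneg _)]
  rw [← Finset.mul_sum, ← mul_add, Real.mul_rpow (by positivity) (by positivity), one_div,
    Real.rpow_rpow_inv (abs_nonneg a) hp0.ne']

/-! ### The seminormed space of functions and its quotient `U` -/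

/-- The linear space of functions with finite Jacobi–Sobolev seminorm, as a subspace of `ℝ → ℝ`. -/
def preU (p α β : ℝ) {ℓ : ℕ} (ω : Fin ℓ → ℝ) [Fact (-1 < α)] [Fact (-1 < β)] :
    Submodule ℝ (ℝ → ℝ) where
  carrier := {f | IsSobolev p α β ω f}
  zero_mem' := by
    have h := isSobolev_polynomial (p := p) (α := α) (β := β) (ω := ω) 0
    have h0 : (fun x : ℝ => (0 : Polynomial ℝ).eval x) = 0 := by ext x; simp
    rwa [h0] at h
  add_mem' {f g} hf hg := by simpa using IsSobolev.comb hf hg 1 1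
  smul_mem' a f hf := by simpa using IsSobolev.comb hf hf a 0

/-- The same space as a type of its own, which carries the Jacobi–Sobolev seminorm (and not the
topology of pointwise convergence). -/
def SobolevFun (p α β : ℝ) {ℓ : ℕ} (ω : Fin ℓ → ℝ) [Fact (-1 < α)] [Fact (-1 < β)] : Type :=
  preU p α β ω

section

variable [Fact (-1 < α)] [Fact (-1 < β)]

instance : AddCommGroup (SobolevFun p α β ω) := inferInstanceAs (AddCommGroup (preU p α β ω))

instance : Module ℝ (SobolevFun p α β ω) := inferInstanceAs (Module ℝ (preU p α β ω))

/-- The function underlying an element of `SobolevFun`. -/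
def SobolevFun.toFun (f : SobolevFun p α β ω) : ℝ → ℝ := f.1

theorem SobolevFun.isSobolev (f : SobolevFun p α β ω) : IsSobolev p α β ω f.toFun := f.2

variable [hp : Fact (1 ≤ p)]

/-- The Jacobi–Sobolev seminorm on the linear space of functions. -/
instance : SeminormedAddCommGroup (SobolevFun p α β ω) :=
  AddGroupSeminorm.toSeminormedAddCommGroup
    { toFun := fun f => sobolevNorm p α β ω f.toFun
      map_zero' := by
        have h := sobolevNorm_smul hp.out 0 (0 : SobolevFun p α β ω).isSobolev
        rw [zero_smul, abs_zero, zero_mul] at h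
        exact h
      add_le' := fun f g => sobolevNorm_add_le hp.out f.isSobolev g.isSobolev
      neg' := fun f => by
        have h := sobolevNorm_smul hp.out (-1) f.isSobolev
        rw [abs_neg, abs_one, one_mul, neg_one_smul] at h
        exact h }

theorem norm_def (f : SobolevFun p α β ω) : ‖f‖ = sobolevNorm p α β ω f.toFun := rfl

instance : NormedSpace ℝ (SobolevFun p α β ω) where
  norm_smul_le a f := (sobolevNorm_smul hp.out a f.isSobolev).le

end

/-- The normed space `U`: functions with finite Jacobi–Sobolev seminorm, where `f ~ g` if and only
if the seminorm of `f - g` is `0`. -/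
abbrev U (p α β : ℝ) {ℓ : ℕ} (ω : Fin ℓ → ℝ) [Fact (1 ≤ p)] [Fact (-1 < α)] [Fact (-1 < β)] :
    Type :=
  SeparationQuotient (SobolevFun p α β ω)

/-! ### The polynomials and their completion `W` -/

/-- The linear space of real polynomials, as a type that carries the Jacobi–Sobolev norm. -/
def SobolevPoly (p α β : ℝ) {ℓ : ℕ} (_ω : Fin ℓ → ℝ) [Fact (1 ≤ p)] [Fact (-1 < α)]
    [Fact (-1 < β)] : Type :=
  Polynomial ℝ

section

variable [Fact (1 ≤ p)] [Fact (-1 < α)] [Fact (-1 < β)]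

instance : AddCommGroup (SobolevPoly p α β ω) := inferInstanceAs (AddCommGroup (Polynomial ℝ))

instance : Module ℝ (SobolevPoly p α β ω) := inferInstanceAs (Module ℝ (Polynomial ℝ))

/-- The underlying polynomial. -/
def SobolevPoly.poly (P : SobolevPoly p α β ω) : Polynomial ℝ := P

/-- A polynomial as a function with finite Jacobi–Sobolev seminorm. -/
def SobolevPoly.toFun : SobolevPoly p α β ω →ₗ[ℝ] SobolevFun p α β ω where
  toFun P := ⟨fun x => P.poly.eval x, isSobolev_polynomial P.poly⟩
  map_add' P Q := Subtype.ext (funext fun _ => Polynomial.eval_add (p := P.poly) (q := Q.poly))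
  map_smul' a P := Subtype.ext (funext fun x => Polynomial.eval_smul (S := ℝ) a P.poly x)

instance : SeminormedAddCommGroup (SobolevPoly p α β ω) :=
  SeminormedAddCommGroup.induced _ _ (SobolevPoly.toFun (p := p) (α := α) (β := β) (ω := ω))

instance : NormedSpace ℝ (SobolevPoly p α β ω) :=
  NormedSpace.induced ℝ _ _ (SobolevPoly.toFun (p := p) (α := α) (β := β) (ω := ω))

theorem SobolevPoly.norm_def (P : SobolevPoly p α β ω) :
    ‖P‖ = sobolevNorm p α β ω (fun x => P.poly.eval x) := rfl

end

/-- The discrete-continuous Jacobi–Sobolev space `W`: the abstract completion (Cauchy sequences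
modulo null sequences) of the polynomials under the Jacobi–Sobolev norm. -/
abbrev W (p α β : ℝ) {ℓ : ℕ} (ω : Fin ℓ → ℝ) [Fact (1 ≤ p)] [Fact (-1 < α)] [Fact (-1 < β)] :
    Type :=
  UniformSpace.Completion (SobolevPoly p α β ω)

/-- The class in `U` of a polynomial. -/
def polyU [Fact (1 ≤ p)] [Fact (-1 < α)] [Fact (-1 < β)] (P : SobolevPoly p α β ω) :
    U p α β ω :=
  SeparationQuotient.mk (SobolevPoly.toFun P)

/-- The image in `W` of a polynomial. -/
def polyW [Fact (1 ≤ p)] [Fact (-1 < α)] [Fact (-1 < β)] (P : SobolevPoly p α β ω) :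
    W p α β ω :=
  (P : UniformSpace.Completion (SobolevPoly p α β ω))

end JacobiSobolev

end

/-!
The map sending `f` to `((f⁽ᵏ⁾(ω_k))_k, f⁽ˡ⁾)` is an isometry into `ℝˡ × Lᵖ(μ)`, and already the
polynomials have dense image: `P⁽ˡ⁾` is arbitrary, hence dense by the Weierstrass theorem, and the
values `P⁽ᵏ⁾(ω_k)` can then be prescribed, the system for a polynomial of degree `< ℓ` being
triangular. So `U` is complete exactly when the map is onto, that is, when every `g ∈ Lᵖ(μ)` is
the `ℓ`-th derivative of some `f` in the space.

The only obstruction is the derivative of order `k ≥ 1` at `ω_k = ±1`. With `m = ℓ - k`, Cauchy's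
formula shows that the `m`-fold primitive of `g ≥ 0` has a finite limit at `1` if and only if
`(1 - t)ᵐ⁻¹ g` is integrable near `1`. By Hölder's inequality this holds for all `g ∈ Lᵖ(μ)` under
the end-point inequality for `m`; otherwise `(1 - t)⁻ᵐ (1 - log (1 - t))⁻¹` for `p > 1`, and
`(1 - t)⁻ᵐ` for `p = 1`, is a counterexample. The reflection `x ↦ -x` exchanges the end points.
-/

noncomputable section

namespace JacobiSobolev

/-! ### Polynomials -/

section Polynomial

open Polynomial

theorem iteratedDeriv_eval (P : ℝ[X]) (k : ℕ) :
    iteratedDeriv k (fun x => P.eval x) = fun x => (derivative^[k] P).eval x := by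
  induction k with
  | zero => simp
  | succ k ih =>
    ext x
    rw [iteratedDeriv_succ, ih, Polynomial.deriv, Function.iterate_succ_apply']

variable {K : Type*} [Field K] [CharZero K]

theorem derivative_surjective : Function.Surjective (derivative : K[X] →ₗ[K] K[X]) := by
  intro R
  induction R using Polynomial.induction_on' with
  | add P Q hP hQ =>
    obtain ⟨P, rfl⟩ := hP
    obtain ⟨Q, rfl⟩ := hQ
    exact ⟨P + Q, map_add _ _ _⟩
  | monomial n a =>
    refine ⟨monomial (n + 1) (a / (n + 1)), ?_⟩
    rw [derivative_monomial, Nat.cast_add_one, div_mul_cancel₀ a (Nat.cast_add_one_ne_zero n),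
      Nat.add_sub_cancel]

theorem exists_derivative_eq_and_eval_eq (R : K[X]) (x y : K) :
    ∃ P : K[X], derivative P = R ∧ P.eval x = y := by
  obtain ⟨P, rfl⟩ := derivative_surjective R
  exact ⟨P + C (y - P.eval x), by simp, by simp⟩

/-- Abel–Gončarov interpolation. -/
theorem exists_iterate_derivative_eq_and_eval_eq {n : ℕ} (ω v : Fin n → K) (R : K[X]) :
    ∃ P : K[X], derivative^[n] P = R ∧ ∀ k : Fin n, (derivative^[k] P).eval (ω k) = v k := by
  induction n generalizing R with
  | zero => exact ⟨R, rfl, fun k => k.elim0⟩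
  | succ n ih =>
    obtain ⟨Q, hQR, hQv⟩ :=
      exists_derivative_eq_and_eval_eq R (ω (Fin.last n)) (v (Fin.last n))
    obtain ⟨P, hPQ, hPv⟩ := ih (fun k => ω k.castSucc) (fun k => v k.castSucc) Q
    refine ⟨P, by rw [Function.iterate_succ_apply', hPQ, hQR], Fin.lastCases ?_ hPv⟩
    rw [Fin.val_last, hPQ, hQv]

end Polynomial

theorem exists_polynomial_eLpNorm_sub_le {μ : Measure ℝ} [IsFiniteMeasure μ] {a b : ℝ}
    (hμ : ∀ᵐ x ∂μ, x ∈ Icc a b) {q : ENNReal} (hq1 : 1 ≤ q) (hq : q ≠ ⊤) {g : ℝ → ℝ}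
    (hg : MemLp g q μ) {ε : ENNReal} (hε : ε ≠ 0) :
    ∃ R : Polynomial ℝ, eLpNorm (g - fun x => R.eval x) q μ ≤ ε := by
  obtain ⟨φ, hgφ, hφ⟩ := hg.exists_boundedContinuous_eLpNorm_sub_le hq (ENNReal.half_pos hε).ne'
  have hμ_top : μ univ ^ q.toReal⁻¹ ≠ ⊤ :=
    ENNReal.rpow_ne_top_of_nonneg (by positivity) (measure_ne_top _ _)
  obtain ⟨δ, hδ, hδε⟩ := ENNReal.exists_nnreal_pos_mul_lt hμ_top (ENNReal.half_pos hε).ne'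
  obtain ⟨R, hR⟩ := exists_polynomial_near_of_continuousOn a b φ φ.continuous.continuousOn δ hδ
  have hφR : eLpNorm ((φ : ℝ → ℝ) - fun x => R.eval x) q μ ≤ ε / 2 := by
    refine (eLpNorm_le_of_ae_bound (C := δ) ?_).trans
      (by rw [mul_comm, ENNReal.ofReal_coe_nnreal]; exact hδε.le)
    filter_upwards [hμ] with x hx
    rw [Real.norm_eq_abs, Pi.sub_apply, abs_sub_comm]
    exact (hR x hx).le
  refine ⟨R, ?_⟩
  calc eLpNorm (g - fun x => R.eval x) q μ
      = eLpNorm ((g - (φ : ℝ → ℝ)) + ((φ : ℝ → ℝ) - fun x => R.eval x)) q μ := by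
        rw [sub_add_sub_cancel]
    _ ≤ eLpNorm (g - (φ : ℝ → ℝ)) q μ + eLpNorm ((φ : ℝ → ℝ) - fun x => R.eval x) q μ :=
        eLpNorm_add_le (hg.sub hφ).1 (hφ.1.sub R.continuous.aestronglyMeasurable) hq1
    _ ≤ ε / 2 + ε / 2 := add_le_add hgφ hφR
    _ = ε := ENNReal.add_halves ε

/-! ### Completeness of the quotient and the isometry into `ℝ^ℓ × L^p(μ)` -/

theorem completeSpace_separationQuotient_iff_surjective {E F : Type*} [UniformSpace E]
    [UniformSpace F] [T0Space F] [CompleteSpace F] {T : E → F} (hT : IsUniformInducing T)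
    (hd : DenseRange T) :
    CompleteSpace (SeparationQuotient E) ↔ Function.Surjective T := by
  rw [← SeparationQuotient.isUniformInducing_mk.completeSpace_congr
    SeparationQuotient.surjective_mk, completeSpace_iff_isComplete_range hT, ← range_eq_univ]
  refine ⟨fun h => h.isClosed.closure_eq.symm.trans hd.closure_range, fun h => ?_⟩
  rw [h]
  exact completeSpace_iff_isComplete_univ.1 inferInstance

theorem exists_linearIsometryEquiv_completion {𝕜 E P : Type*} [NontriviallyNormedField 𝕜]
    [SeminormedAddCommGroup E] [NormedSpace 𝕜 E] [SeminormedAddCommGroup P] [NormedSpace 𝕜 P]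
    [CompleteSpace (SeparationQuotient E)] (i : P →ₗᵢ[𝕜] E) (hi : DenseRange i) :
    ∃ e : SeparationQuotient E ≃ₗᵢ[𝕜] UniformSpace.Completion P,
      ∀ x : P, e (SeparationQuotient.mk (i x)) = x := by
  let i₁ : P →ₗ[𝕜] SeparationQuotient E :=
    (SeparationQuotient.mkCLM 𝕜 E).toLinearMap ∘ₗ i.toLinearMap
  let i₂ : P →ₗ[𝕜] UniformSpace.Completion P :=
    (UniformSpace.Completion.toComplL (𝕜 := 𝕜) (E := P)).toLinearMap
  have hd₁ : DenseRange i₁ := SeparationQuotient.surjective_mk.denseRange.comp hi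
    SeparationQuotient.continuous_mk
  have hd₂ : DenseRange i₂ := UniformSpace.Completion.denseRange_coe
  have hnorm : ∀ x, ‖i₂ (LinearEquiv.refl 𝕜 P x)‖ = ‖i₁ x‖ := fun x =>
    (UniformSpace.Completion.norm_coe x).trans
      ((i.norm_map x).symm.trans (SeparationQuotient.norm_mk (i x)).symm)
  exact ⟨(LinearEquiv.refl 𝕜 P).extendOfIsometry i₁ i₂ hd₁ hd₂ hnorm,
    LinearEquiv.extendOfIsometry_eq (LinearEquiv.refl 𝕜 P) i₁ i₂ hd₁ hd₂ hnorm⟩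

section Jet

variable {p α β : ℝ} {ℓ : ℕ} {ω : Fin ℓ → ℝ}

theorem ae_jacobi_mem_Icc : ∀ᵐ x ∂(jacobiMeasure α β), x ∈ Icc (-1 : ℝ) 1 :=
  ae_jacobi_of_ae (Eventually.of_forall fun _ hx => Ioo_subset_Icc_self hx)

variable (p α β ω) in
/-- `g` is, up to a null set, the derivative `f^(ℓ)` of a function `f` with finite Jacobi–Sobolev
seminorm. -/
def IsTopDeriv (g : ℝ → ℝ) : Prop :=
  ∃ f, IsSobolev p α β ω f ∧ iteratedDeriv ℓ f =ᵐ[jacobiMeasure α β] g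

theorem IsTopDeriv.add {g h : ℝ → ℝ} (hg : IsTopDeriv p α β ω g) (hh : IsTopDeriv p α β ω h) :
    IsTopDeriv p α β ω (g + h) := by
  obtain ⟨u, hu, hug⟩ := hg
  obtain ⟨v, hv, hvh⟩ := hh
  refine ⟨u + v, by simpa using hu.comb hv 1 1, ?_⟩
  have huv := hu.ae_comb hv 1 1
  simp only [one_smul] at huv
  exact huv.trans (hug.add hvh)

theorem IsTopDeriv.congr_ae {g h : ℝ → ℝ} (hg : IsTopDeriv p α β ω g)
    (hgh : g =ᵐ[jacobiMeasure α β] h) : IsTopDeriv p α β ω h := by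
  obtain ⟨f, hf, hfg⟩ := hg
  exact ⟨f, hf, hfg.trans hgh⟩

/-- The product of `ℝ^ℓ` and `L^p(μ)`, with the `p`-norm of the two norms. -/
abbrev JetSpace (p α β : ℝ) (ℓ : ℕ) : Type :=
  WithLp (ENNReal.ofReal p)
    (PiLp (ENNReal.ofReal p) (fun _ : Fin ℓ => ℝ) × Lp ℝ (ENNReal.ofReal p) (jacobiMeasure α β))

variable [Fact (-1 < α)] [Fact (-1 < β)]

/-- The data `((f^(k)(ω_k))_k, f^(ℓ))` that determine `f` up to seminorm zero. -/
def jetData (f : SobolevFun p α β ω) : JetSpace p α β ℓ :=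
  WithLp.toLp _ (WithLp.toLp _ fun k => iteratedDeriv k f.toFun (ω k), f.isSobolev.memLp.toLp _)

theorem jetData_eq_iff {f : SobolevFun p α β ω} {y : JetSpace p α β ℓ} :
    jetData f = y ↔ (∀ k : Fin ℓ, iteratedDeriv k f.toFun (ω k) = y.fst k) ∧
      iteratedDeriv ℓ f.toFun =ᵐ[jacobiMeasure α β] y.snd := by
  rw [← MemLp.toLp_eq_toLp_iff f.isSobolev.memLp (Lp.memLp y.snd), Lp.toLp_coeFn]
  refine ⟨?_, fun ⟨h₁, h₂⟩ => ?_⟩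
  · rintro rfl
    exact ⟨fun _ => rfl, rfl⟩
  · have : (WithLp.toLp _ fun k : Fin ℓ => iteratedDeriv k f.toFun (ω k)) = y.fst :=
      PiLp.ext h₁
    rw [jetData, h₂, this]
    rfl

theorem jetData_comb (a b : ℝ) (f g : SobolevFun p α β ω) :
    jetData (a • f + b • g) = a • jetData f + b • jetData g := by
  refine jetData_eq_iff.2 ⟨fun k => ((f.isSobolev.deriv_at k).comb a b (g.isSobolev.deriv_at k)).2,
    (f.isSobolev.ae_comb g.isSobolev a b).trans ?_⟩
  change _ =ᵐ[_] ⇑(a • f.isSobolev.memLp.toLp _ + b • g.isSobolev.memLp.toLp _)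
  rw [← MemLp.toLp_const_smul, ← MemLp.toLp_const_smul, ← MemLp.toLp_add]
  exact (MemLp.coeFn_toLp _).symm

variable [hp : Fact (1 ≤ p)]

instance fact_one_le_ofReal : Fact (1 ≤ ENNReal.ofReal p) :=
  ⟨by simpa using hp.out⟩

theorem norm_jetData (f : SobolevFun p α β ω) : ‖jetData f‖ = ‖f‖ := by
  have hp0 : 0 < p := by linarith [hp.out]
  have hp0' : 0 < (ENNReal.ofReal p).toReal := by rwa [ENNReal.toReal_ofReal hp0.le]
  have hnodes : 0 ≤ ∑ k : Fin ℓ, |iteratedDeriv k f.toFun (ω k)| ^ p := by positivity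
  rw [norm_def, sobolevNorm, WithLp.prod_norm_eq_add hp0',
    PiLp.norm_eq_sum hp0', ENNReal.toReal_ofReal hp0.le]
  congr 2
  · change ((∑ k : Fin ℓ, |iteratedDeriv k f.toFun (ω k)| ^ p) ^ (1 / p)) ^ p = _
    rw [one_div, Real.rpow_inv_rpow hnodes hp0.ne']
  · change ‖f.isSobolev.memLp.toLp _‖ ^ p = _
    rw [Lp.norm_toLp, integral_eq_eLpNorm hp.out f.isSobolev.memLp,
      abs_of_nonneg ENNReal.toReal_nonneg]

variable (p α β ω) in
/-- `jetData` as a linear isometry. -/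
def jet : SobolevFun p α β ω →ₗᵢ[ℝ] JetSpace p α β ℓ where
  toFun := jetData
  map_add' f g := by simpa using jetData_comb 1 1 f g
  map_smul' a f := by simpa using jetData_comb a 0 f f
  norm_map' := norm_jetData

theorem exists_polynomial_jetData_fst_eq (v : Fin ℓ → ℝ) (R : Polynomial ℝ) :
    ∃ P : SobolevPoly p α β ω, (∀ k, (jetData P.toFun).fst k = v k) ∧
      iteratedDeriv ℓ P.toFun.toFun = fun x => R.eval x := by
  obtain ⟨P, hPR, hPv⟩ := exists_iterate_derivative_eq_and_eval_eq ω v R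
  refine ⟨P, fun k => ?_, ?_⟩
  · exact (congrFun (iteratedDeriv_eval P k) (ω k)).trans (hPv k)
  · exact (iteratedDeriv_eval P ℓ).trans (by rw [hPR])

theorem denseRange_jet_polynomial :
    DenseRange fun P : SobolevPoly p α β ω => jet p α β ω P.toFun := by
  have hp0 : 0 < p := by linarith [hp.out]
  have hp0' : 0 < (ENNReal.ofReal p).toReal := by rwa [ENNReal.toReal_ofReal hp0.le]
  refine fun y => Metric.mem_closure_range_iff.2 fun ε hε => ?_
  obtain ⟨R, hR⟩ := exists_polynomial_eLpNorm_sub_le ae_jacobi_mem_Icc Fact.out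
    ENNReal.ofReal_ne_top (Lp.memLp y.snd) (ε := ENNReal.ofReal (ε / 2)) (by simpa using hε)
  obtain ⟨P, hPv, hPR⟩ := exists_polynomial_jetData_fst_eq (p := p) (α := α) (β := β) y.fst R
  refine ⟨P, ?_⟩
  have hfst : (y - jetData P.toFun).fst = 0 := PiLp.ext fun k => by
    change y.fst k - (jetData P.toFun).fst k = 0
    rw [hPv, sub_self]
  have hsnd : ‖(y - jetData P.toFun).snd‖ ≤ ε / 2 := by
    change ‖y.snd - P.toFun.isSobolev.memLp.toLp _‖ ≤ ε / 2
    rw [Lp.norm_def]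
    refine ENNReal.toReal_le_of_le_ofReal (by positivity) (le_of_eq_of_le ?_ hR)
    refine eLpNorm_congr_ae ((Lp.coeFn_sub _ _).trans ?_)
    rw [← hPR]
    exact EventuallyEq.rfl.sub (MemLp.coeFn_toLp _)
  calc dist y (jetData P.toFun) = ‖(y - jetData P.toFun).snd‖ := by
        rw [dist_eq_norm, WithLp.prod_norm_eq_add hp0', hfst, norm_zero,
          ENNReal.toReal_ofReal hp0.le, Real.zero_rpow hp0.ne', zero_add, one_div,
          Real.rpow_rpow_inv (norm_nonneg _) hp0.ne']
    _ < ε := by linarith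

theorem denseRange_polynomial :
    DenseRange (SobolevPoly.toFun : SobolevPoly p α β ω →ₗ[ℝ] SobolevFun p α β ω) :=
  fun f => Metric.mem_closure_range_iff.2 fun ε hε => by
    obtain ⟨P, hP⟩ := Metric.denseRange_iff.1 denseRange_jet_polynomial (jet p α β ω f) ε hε
    exact ⟨P, by rwa [(jet p α β ω).isometry.dist_eq] at hP⟩

theorem surjective_jet_iff :
    Function.Surjective (jet p α β ω) ↔
      ∀ g, MemLp g (ENNReal.ofReal p) (jacobiMeasure α β) → IsTopDeriv p α β ω g := by
  constructor
  · intro h g hg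
    obtain ⟨f, hf⟩ := h (WithLp.toLp _ (0, hg.toLp g))
    exact ⟨f.toFun, f.isSobolev, (jetData_eq_iff.1 hf).2.trans hg.coeFn_toLp⟩
  · intro h y
    obtain ⟨f, hf, hfy⟩ := h _ (Lp.memLp y.snd)
    obtain ⟨f, rfl⟩ : ∃ F : SobolevFun p α β ω, F.toFun = f := ⟨⟨f, hf⟩, rfl⟩
    obtain ⟨P, hPv, hP⟩ := exists_polynomial_jetData_fst_eq (p := p) (α := α) (β := β)
      (ω := ω) (fun k => y.fst k - iteratedDeriv k f.toFun (ω k)) 0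
    refine ⟨(1 : ℝ) • f + (1 : ℝ) • P.toFun, jetData_eq_iff.2 ⟨fun k => ?_, ?_⟩⟩
    · refine ((f.isSobolev.deriv_at k).comb 1 1 (P.toFun.isSobolev.deriv_at k)).2.trans ?_
      rw [one_mul, one_mul, ← add_sub_cancel (iteratedDeriv k f.toFun (ω k)) (y.fst k)]
      exact congrArg _ (hPv k)
    · refine (f.isSobolev.ae_comb P.toFun.isSobolev 1 1).trans ?_
      filter_upwards [hfy] with x hx
      simp [hP, hx]

theorem completeSpace_U_iff : CompleteSpace (U p α β ω) ↔
    ∀ g, MemLp g (ENNReal.ofReal p) (jacobiMeasure α β) → IsTopDeriv p α β ω g :=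
  (completeSpace_separationQuotient_iff_surjective (jet p α β ω).isometry.isUniformInducing
    (denseRange_jet_polynomial.mono (range_comp_subset_range _ _))).trans surjective_jet_iff

theorem exists_linearIsometryEquiv_of_completeSpace [CompleteSpace (U p α β ω)] :
    ∃ e : U p α β ω ≃ₗᵢ[ℝ] W p α β ω, ∀ P : SobolevPoly p α β ω, e (polyU P) = polyW P :=
  let i : SobolevPoly p α β ω →ₗᵢ[ℝ] SobolevFun p α β ω := ⟨SobolevPoly.toFun, fun _ => rfl⟩
  exists_linearIsometryEquiv_completion i denseRange_polynomial

end Jet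

/-! ### Derivatives of a given order -/

section HasDerivOfOrder

variable {f g : ℝ → ℝ} {j k m : ℕ} {x : ℝ}

theorem HasDerivOfOrder.mono (h : HasDerivOfOrder f k x) (hjk : j ≤ k) :
    HasDerivOfOrder f j x := by
  induction hjk with
  | refl => exact h
  | step _ ih => exact ih h.1.self_of_nhds

theorem HasDerivOfOrder.congr (h : HasDerivOfOrder f k x) (hfg : g =ᶠ[𝓝 x] f) :
    HasDerivOfOrder g k x := by
  induction k generalizing x with
  | zero => trivial
  | succ k ih =>
    refine ⟨?_, (hfg.iteratedDeriv k).differentiableAt_iff.2 h.2⟩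
    filter_upwards [h.1, hfg.eventually_nhds] with y hy hyfg using ih hy hyfg

theorem iteratedDeriv_iteratedDeriv (j k : ℕ) (f : ℝ → ℝ) :
    iteratedDeriv j (iteratedDeriv k f) = iteratedDeriv (j + k) f := by
  simp only [iteratedDeriv_eq_iterate, Function.iterate_add_apply]

theorem HasDerivOfOrder.hasDerivAt (h : HasDerivOfOrder f k x) (hjk : j < k) :
    HasDerivAt (iteratedDeriv j f) (iteratedDeriv (j + 1) f x) x := by
  rw [iteratedDeriv_succ]
  exact (h.mono (Nat.succ_le_of_lt hjk)).2.hasDerivAt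

theorem hasDerivOfOrder_iteratedDeriv_iff (hf : ∀ᶠ y in 𝓝 x, HasDerivOfOrder f k y) :
    HasDerivOfOrder (iteratedDeriv k f) j x ↔ HasDerivOfOrder f (j + k) x := by
  induction j generalizing x with
  | zero => simpa [HasDerivOfOrder] using hf.self_of_nhds
  | succ j ih =>
    rw [Nat.add_right_comm]
    refine and_congr (eventually_congr ?_) (by rw [iteratedDeriv_iteratedDeriv])
    filter_upwards [hf.eventually_nhds] with y hy using ih hy

theorem HasDerivOfOrder.isBounded_image {s : Set ℝ} (hs : Convex ℝ s)
    (hs' : Bornology.IsBounded s) (hf : ∀ x ∈ s, HasDerivOfOrder f k x)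
    (h : Bornology.IsBounded (iteratedDeriv k f '' s)) : Bornology.IsBounded (f '' s) := by
  induction k with
  | zero => simpa using h
  | succ k ih =>
    refine ih (fun x hx => (hf x hx).mono k.le_succ) ?_
    obtain ⟨C, hC⟩ := h.exists_norm_le
    have hlip : LipschitzOnWith C.toNNReal (iteratedDeriv k f) s :=
      hs.lipschitzOnWith_of_nnnorm_hasDerivWithin_le
        (fun x hx => ((hf x hx).hasDerivAt k.lt_succ_self).hasDerivWithinAt)
        fun x hx => NNReal.le_toNNReal_of_coe_le (hC _ (mem_image_of_mem _ hx))
    obtain ⟨w, hw, hfw⟩ := hlip.extend_real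
    rw [hfw.image_eq]
    exact hw.isBounded_image hs'

theorem iteratedDeriv_fun_neg_arg (k : ℕ) (f : ℝ → ℝ) :
    iteratedDeriv k (fun x => f (-x)) = fun x => (-1) ^ k * iteratedDeriv k f (-x) :=
  funext fun x => by simpa using iteratedDeriv_comp_neg k f x

theorem HasDerivOfOrder.comp_neg (h : HasDerivOfOrder f k (-x)) :
    HasDerivOfOrder (fun x => f (-x)) k x := by
  induction k generalizing x with
  | zero => trivial
  | succ k ih =>
    refine ⟨?_, ?_⟩
    · filter_upwards [(continuous_neg.tendsto x).eventually h.1] with y hy using ih hy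
    · rw [iteratedDeriv_fun_neg_arg]
      exact (h.2.comp x differentiableAt_id.neg).const_mul _

end HasDerivOfOrder

/-! ### Reflection -/

section Reflection

theorem absolutelyContinuousOnInterval_congr {f g : ℝ → ℝ} {a b : ℝ} (h : EqOn f g (uIcc a b)) :
    AbsolutelyContinuousOnInterval f a b ↔ AbsolutelyContinuousOnInterval g a b := by
  simp only [absolutelyContinuousOnInterval_iff]
  refine forall₂_congr fun ε _ => exists_congr fun δ => and_congr_right fun _ =>
    forall₂_congr fun E hE => imp_congr_right fun _ => ?_
  rw [Finset.sum_congr rfl fun i hi => by rw [h (hE.1 i hi).1, h (hE.1 i hi).2]]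

theorem absolutelyContinuousOnInterval_comp_neg {f : ℝ → ℝ} {a b : ℝ}
    (hf : AbsolutelyContinuousOnInterval f (-a) (-b)) :
    AbsolutelyContinuousOnInterval (fun x => f (-x)) a b := by
  have hint : IntervalIntegrable (fun x => deriv f (-x)) volume a b := by
    simpa using hf.intervalIntegrable_deriv.comp_mul_left (c := -1)
  have hprim : AbsolutelyContinuousOnInterval
      (fun x => f (-a) - ∫ t in a..x, deriv f (-t)) a b :=
    contDiff_const.contDiffOn.absolutelyContinuousOnInterval.sub
      (hint.absolutelyContinuousOnInterval_intervalIntegral left_mem_uIcc)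
  refine (absolutelyContinuousOnInterval_congr fun x hx => ?_).2 hprim
  have hfx : AbsolutelyContinuousOnInterval f (-a) (-x) := hf.mono (by
    rw [← image_neg_uIcc, ← image_neg_uIcc]
    exact image_mono (uIcc_subset_uIcc_left hx))
  rw [intervalIntegral.integral_comp_neg, intervalIntegral.integral_symm,
    hfx.integral_deriv_eq_sub]
  ring

variable {p α β : ℝ} {ℓ : ℕ} {ω : Fin ℓ → ℝ}

theorem measurePreserving_neg_jacobi (α β : ℝ) :
    MeasurePreserving Neg.neg (jacobiMeasure α β) (jacobiMeasure β α) := by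
  refine ⟨measurable_neg, Measure.ext fun s hs => ?_⟩
  have hpre : Neg.neg ⁻¹' (s ∩ Icc (-1 : ℝ) 1) = Neg.neg ⁻¹' s ∩ Icc (-1 : ℝ) 1 := by simp
  rw [Measure.map_apply measurable_neg hs, jacobiMeasure, jacobiMeasure,
    withDensity_apply _ (measurable_neg hs), withDensity_apply _ hs,
    Measure.restrict_restrict (measurable_neg hs), Measure.restrict_restrict hs,
    ← (Measure.measurePreserving_neg volume).setLIntegral_comp_preimage_emb
      (MeasurableEquiv.neg ℝ).measurableEmbedding _ (s ∩ Icc (-1) 1), hpre]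
  refine lintegral_congr fun x => ?_
  rw [sub_neg_eq_add, ← sub_eq_add_neg, mul_comm]

theorem memLp_jacobi_comp_neg {g : ℝ → ℝ} {q : ENNReal} (hg : MemLp g q (jacobiMeasure α β)) :
    MemLp (fun x => g (-x)) q (jacobiMeasure β α) :=
  hg.comp_measurePreserving (measurePreserving_neg_jacobi β α)

theorem IsSobolev.comp_neg {f : ℝ → ℝ} (hf : IsSobolev p α β ω f) :
    IsSobolev p β α (-ω) (fun x => f (-x)) where
  deriv_at k := HasDerivOfOrder.comp_neg (by simpa using hf.deriv_at k)
  deriv_on x hx :=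
    HasDerivOfOrder.comp_neg (hf.deriv_on (-x) ⟨neg_lt_neg hx.2, neg_lt.1 hx.1⟩)
  absCont a b ha hab hb := by
    rw [iteratedDeriv_fun_neg_arg]
    exact (absolutelyContinuousOnInterval_comp_neg
      (hf.absCont (-b) (-a) (neg_lt_neg hb) (neg_le_neg hab) (neg_lt.1 ha)).symm).const_mul _
  memLp := by
    rw [iteratedDeriv_fun_neg_arg]
    exact (memLp_jacobi_comp_neg hf.memLp).const_mul _

theorem IsTopDeriv.comp_neg {g : ℝ → ℝ} (h : IsTopDeriv p α β ω fun x => (-1) ^ ℓ * g x) :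
    IsTopDeriv p β α (-ω) fun x => g (-x) := by
  obtain ⟨f, hf, hfg⟩ := h
  refine ⟨_, hf.comp_neg, ?_⟩
  rw [iteratedDeriv_fun_neg_arg]
  filter_upwards [(measurePreserving_neg_jacobi β α).quasiMeasurePreserving.ae hfg] with x hx
  rw [hx, ← mul_assoc, ← mul_pow, neg_one_mul, neg_neg, one_pow, one_mul]

end Reflection

/-! ### Iterated primitives -/

/-- The primitive of `g` that vanishes at the base point `a`; its iterates in `g` are the iterated
primitives. -/
def primitive (a : ℝ) (g : ℝ → ℝ) (x : ℝ) : ℝ := ∫ t in a..x, g t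

section Primitive

variable {g : ℝ → ℝ} {s : Set ℝ} {a b c x : ℝ} {m n : ℕ}

theorem intervalIntegrable_of_locallyIntegrableOn (hg : LocallyIntegrableOn g s)
    (hab : uIcc a b ⊆ s) : IntervalIntegrable g volume a b :=
  intervalIntegrable_iff.2
    ((hg.integrableOn_compact_subset hab isCompact_uIcc).mono_set uIoc_subset_uIcc)

theorem exists_uIcc_subset [hs : s.OrdConnected] (ha : a ∈ s) (hb : b ∈ s) (hc : c ∈ s) :
    ∃ u v, a ∈ uIcc u v ∧ uIcc b c ⊆ uIcc u v ∧ uIcc u v ⊆ s := by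
  have hle : min a (min b c) ≤ max a (max b c) := (min_le_left _ _).trans (le_max_left _ _)
  refine ⟨min a (min b c), max a (max b c), ?_, ?_, hs.uIcc_subset
    (min_rec' (· ∈ s) ha (min_rec' (· ∈ s) hb hc)) (max_rec' (· ∈ s) ha (max_rec' (· ∈ s) hb hc))⟩
    <;> rw [uIcc_of_le hle]
  · exact ⟨min_le_left _ _, le_max_left _ _⟩
  · exact Icc_subset_Icc (min_le_right _ _) (le_max_right _ _)

theorem absolutelyContinuousOnInterval_primitive [s.OrdConnected]
    (hg : LocallyIntegrableOn g s) (ha : a ∈ s) (hb : b ∈ s) (hc : c ∈ s) :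
    AbsolutelyContinuousOnInterval (primitive a g) b c := by
  obtain ⟨u, v, hauv, hbc, huv⟩ := exists_uIcc_subset ha hb hc
  exact ((intervalIntegrable_of_locallyIntegrableOn hg huv
    ).absolutelyContinuousOnInterval_intervalIntegral hauv).mono hbc

theorem continuousOn_primitive [s.OrdConnected] (hs : IsOpen s) (hg : LocallyIntegrableOn g s)
    (ha : a ∈ s) : ContinuousOn (primitive a g) s := by
  intro x hx
  obtain ⟨b, c, hxbc, hbc, hbcs⟩ := exists_Icc_mem_subset_of_mem_nhds (hs.mem_nhds hx)
  have hle : b ≤ c := hxbc.1.trans hxbc.2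
  have hac := absolutelyContinuousOnInterval_primitive hg ha (hbcs (left_mem_Icc.2 hle))
    (hbcs (right_mem_Icc.2 hle))
  refine (hac.continuousOn.continuousAt ?_).continuousWithinAt
  rwa [uIcc_of_le hle]

theorem ae_hasDerivAt_primitive [s.OrdConnected] (hs : IsOpen s) (hg : LocallyIntegrableOn g s)
    (ha : a ∈ s) : ∀ᵐ x, x ∈ s → HasDerivAt (primitive a g) (g x) x := by
  rw [ae_iff]
  refine measure_null_of_locally_null _ fun x hx => ?_
  obtain ⟨hxs, -⟩ := Classical.not_imp.1 hx
  obtain ⟨b, c, hxbc, hbc, hbcs⟩ := exists_Icc_mem_subset_of_mem_nhds (hs.mem_nhds hxs)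
  have hle : b ≤ c := hxbc.1.trans hxbc.2
  obtain ⟨u, v, hauv, hsub, huv⟩ := exists_uIcc_subset ha (hbcs (left_mem_Icc.2 hle))
    (hbcs (right_mem_Icc.2 hle))
  rw [uIcc_of_le hle] at hsub
  have hae := (intervalIntegrable_of_locallyIntegrableOn hg huv).ae_hasDerivAt_integral
  refine ⟨_, inter_mem_nhdsWithin _ hbc, measure_mono_null ?_ (ae_iff.1 hae)⟩
  exact fun y hy hderiv => hy.1 fun _ => hderiv (hsub hy.2) a hauv

theorem hasDerivAt_primitive [hs' : s.OrdConnected] (hs : IsOpen s) (hg : ContinuousOn g s)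
    (ha : a ∈ s) (hx : x ∈ s) : HasDerivAt (primitive a g) (g x) x :=
  intervalIntegral.integral_hasDerivAt_right (hg.mono (hs'.uIcc_subset ha hx)).intervalIntegrable
    (hg.stronglyMeasurableAtFilter hs x hx) (hg.continuousAt (hs.mem_nhds hx))

theorem continuousOn_iterate_primitive [s.OrdConnected] (hs : IsOpen s)
    (hg : LocallyIntegrableOn g s) (ha : a ∈ s) (m : ℕ) :
    ContinuousOn ((primitive a)^[m + 1] g) s := by
  induction m with
  | zero => exact continuousOn_primitive hs hg ha
  | succ m ih =>
    rw [Function.iterate_succ_apply']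
    exact continuousOn_primitive hs (ih.locallyIntegrableOn hs.measurableSet) ha

theorem hasDerivOfOrder_iterate_primitive [s.OrdConnected] (hs : IsOpen s)
    (hg : n ≠ 0 → ContinuousOn g s) (ha : a ∈ s) (hx : x ∈ s) :
    HasDerivOfOrder ((primitive a)^[n] g) n x ∧ iteratedDeriv n ((primitive a)^[n] g) x = g x := by
  induction n generalizing g x with
  | zero => exact ⟨trivial, rfl⟩
  | succ n ih =>
    have hcont : ContinuousOn g s := hg n.succ_ne_zero
    have hprim : ContinuousOn (primitive a g) s := fun y hy =>
      (hasDerivAt_primitive hs hcont ha hy).continuousAt.continuousWithinAt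
    rw [Function.iterate_succ_apply]
    have hderiv : iteratedDeriv n ((primitive a)^[n] (primitive a g)) =ᶠ[𝓝 x] primitive a g :=
      eventually_of_mem (hs.mem_nhds hx) fun y hy => (ih (fun _ => hprim) hy).2
    have hx' := (hasDerivAt_primitive hs hcont ha hx).congr_of_eventuallyEq hderiv
    refine ⟨⟨eventually_of_mem (hs.mem_nhds hx) fun y hy => (ih (fun _ => hprim) hy).1,
      hx'.differentiableAt⟩, ?_⟩
    rw [iteratedDeriv_succ, hx'.deriv]

theorem hasDerivAt_neg_sub_pow_div_factorial (x t : ℝ) (m : ℕ) :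
    HasDerivAt (fun t => -((x - t) ^ (m + 1) / (m + 1).factorial))
      ((x - t) ^ m / m.factorial) t := by
  have h := (((hasDerivAt_id t).const_sub x).pow (m + 1)).div_const
    ((m + 1).factorial : ℝ) |>.neg
  convert! h using 1
  rw [Nat.factorial_succ]
  push_cast
  simp only [id]
  field_simp

/-- Cauchy's formula for repeated integration. -/
theorem iterate_primitive_eq_integral (hg : IntervalIntegrable g volume a x) :
    (primitive a)^[m + 1] g x = ∫ t in a..x, (x - t) ^ m / m.factorial * g t := by
  induction m generalizing g with
  | zero => simp [primitive]
  | succ m ih =>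
    have hprim : AbsolutelyContinuousOnInterval (primitive a g) a x :=
      hg.absolutelyContinuousOnInterval_intervalIntegral left_mem_uIcc
    have hkernel : AbsolutelyContinuousOnInterval
        (fun t => -((x - t) ^ (m + 1) / ((m + 1).factorial : ℝ))) a x :=
      ContDiffOn.absolutelyContinuousOnInterval (by fun_prop)
    have hparts := hprim.integral_mul_deriv_eq_deriv_mul hkernel
    have hae : ∀ᵐ t, t ∈ uIoc a x → deriv (primitive a g) t = g t := by
      filter_upwards [hg.ae_hasDerivAt_integral] with t ht hta
      exact (ht (uIoc_subset_uIcc hta) a left_mem_uIcc).deriv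
    calc (primitive a)^[m + 1 + 1] g x
        = ∫ t in a..x, (x - t) ^ m / m.factorial * primitive a g t := by
          rw [Function.iterate_succ_apply, ih hprim.continuousOn.intervalIntegrable]
      _ = -∫ t in a..x, deriv (primitive a g) t * -((x - t) ^ (m + 1) / (m + 1).factorial) := by
          simp only [(hasDerivAt_neg_sub_pow_div_factorial x _ m).deriv] at hparts
          simp only [mul_comm _ (primitive a g _)]
          rw [hparts]
          simp [primitive]
      _ = ∫ t in a..x, (x - t) ^ (m + 1) / (m + 1).factorial * g t := by
          rw [← intervalIntegral.integral_neg]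
          refine intervalIntegral.integral_congr_ae ?_
          filter_upwards [hae] with t ht hta
          rw [ht hta]
          ring

end Primitive

section PrimitiveLimit

variable {g : ℝ → ℝ} {a b t x : ℝ} {m : ℕ}

theorem Ioo_inter_Iic_of_mem (hx : x ∈ Ioo a b) : Ioo a b ∩ Iic x = Ioc a x := by
  ext t
  simp only [mem_inter_iff, mem_Ioo, mem_Iic, mem_Ioc]
  exact ⟨fun h => ⟨h.1.1, h.2⟩, fun h => ⟨⟨h.1, h.2.trans_lt hx.2⟩, h.2⟩⟩

theorem intervalIntegrable_of_mem_Ioo (hg : LocallyIntegrableOn g (Ico a b)) (hx : x ∈ Ioo a b) :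
    IntervalIntegrable g volume a x := by
  refine intervalIntegrable_of_locallyIntegrableOn hg ?_
  rw [uIcc_of_le hx.1.le]
  exact Icc_subset_Ico_right hx.2

theorem iterate_primitive_eq_setIntegral (hg : LocallyIntegrableOn g (Ico a b))
    (hx : x ∈ Ioo a b) : (primitive a)^[m + 1] g x =
      (∫ t in Ioo a b, (Iic x).indicator (fun t => (x - t) ^ m * g t) t) / m.factorial := by
  rw [iterate_primitive_eq_integral (intervalIntegrable_of_mem_Ioo hg hx),
    intervalIntegral.integral_of_le hx.1.le, setIntegral_indicator measurableSet_Iic,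
    Ioo_inter_Iic_of_mem hx, ← integral_div]
  simp only [div_mul_eq_mul_div]

theorem tendsto_indicator_pow_mul (g : ℝ → ℝ) (m : ℕ) (ht : t < b) :
    Tendsto (fun x => (Iic x).indicator (fun t => (x - t) ^ m * g t) t) (𝓝[<] b)
      (𝓝 ((b - t) ^ m * g t)) := by
  have hcont : Continuous fun x => (x - t) ^ m * g t := by fun_prop
  refine (hcont.tendsto b).mono_left nhdsWithin_le_nhds |>.congr' ?_
  filter_upwards [Ioo_mem_nhdsLT ht] with x hx
  exact (indicator_of_mem (mem_Iic.2 hx.1.le) fun t => (x - t) ^ m * g t).symm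

theorem integrableOn_indicator_pow_mul (hg : LocallyIntegrableOn g (Ico a b)) (hx : x ∈ Ioo a b) :
    IntegrableOn ((Iic x).indicator fun t => (x - t) ^ m * g t) (Ioo a b) := by
  rw [IntegrableOn, integrable_indicator_iff measurableSet_Iic, IntegrableOn,
    Measure.restrict_restrict measurableSet_Iic, inter_comm, Ioo_inter_Iic_of_mem hx]
  exact (((intervalIntegrable_of_mem_Ioo hg hx).continuousOn_mul
    (by fun_prop : Continuous fun t => (x - t) ^ m).continuousOn)).1

theorem exists_tendsto_iterate_primitive (hab : a < b) (hg : LocallyIntegrableOn g (Ico a b))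
    (hint : IntegrableOn (fun t => (b - t) ^ m * g t) (Ioo a b)) :
    ∃ L, Tendsto ((primitive a)^[m + 1] g) (𝓝[<] b) (𝓝 L) := by
  have hdom : ∀ x ∈ Ioo a b, ∀ t,
      ‖(Iic x).indicator (fun t => (x - t) ^ m * g t) t‖ ≤ ‖(b - t) ^ m * g t‖ := by
    intro x hx t
    rw [norm_indicator_eq_indicator_norm]
    refine indicator_le' (g := fun t => ‖(b - t) ^ m * g t‖) (fun t ht => ?_)
      (fun t _ => norm_nonneg _) t
    have hxt : 0 ≤ x - t := sub_nonneg.2 ht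
    have hxb : x - t ≤ b - t := by linarith [hx.2]
    rw [norm_mul, norm_mul, norm_pow, norm_pow, Real.norm_of_nonneg hxt,
      Real.norm_of_nonneg (hxt.trans hxb)]
    gcongr
  have hlim : Tendsto
      (fun x => ∫ t in Ioo a b, (Iic x).indicator (fun t => (x - t) ^ m * g t) t) (𝓝[<] b)
      (𝓝 (∫ t in Ioo a b, (b - t) ^ m * g t)) := by
    refine tendsto_integral_filter_of_dominated_convergence _
      (eventually_of_mem (Ioo_mem_nhdsLT hab) fun x hx =>
        (integrableOn_indicator_pow_mul hg hx).aestronglyMeasurable)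
      (eventually_of_mem (Ioo_mem_nhdsLT hab) fun x hx => Eventually.of_forall (hdom x hx))
      hint.norm
      (ae_restrict_of_forall_mem measurableSet_Ioo fun t ht => tendsto_indicator_pow_mul g m ht.2)
  refine ⟨_, (hlim.div_const (m.factorial : ℝ)).congr' ?_⟩
  filter_upwards [Ioo_mem_nhdsLT hab] with x hx using (iterate_primitive_eq_setIntegral hg hx).symm

theorem tendsto_iterate_primitive_atTop (hab : a < b) (hg : LocallyIntegrableOn g (Ico a b))
    (hg0 : ∀ t ∈ Ioo a b, 0 ≤ g t)
    (hint : ¬ IntegrableOn (fun t => (b - t) ^ m * g t) (Ioo a b)) :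
    Tendsto ((primitive a)^[m + 1] g) (𝓝[<] b) atTop := by
  refine tendsto_atTop.2 fun M => by_contra fun hM => hint ?_
  obtain ⟨u, hub, hu⟩ := exists_seq_forall_of_frequently
    ((not_eventually.1 hM).and_eventually (Ioo_mem_nhdsLT hab))
  set G : ℕ → ℝ → ℝ := fun i => (Iic (u i)).indicator fun t => (u i - t) ^ m * g t
  have hG : ∀ i, IntegrableOn (G i) (Ioo a b) := fun i => integrableOn_indicator_pow_mul hg (hu i).2
  have hG0 : ∀ i, ∀ t ∈ Ioo a b, 0 ≤ G i t := fun i t ht => indicator_apply_nonneg fun hti =>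
    mul_nonneg (pow_nonneg (sub_nonneg.2 hti) m) (hg0 t ht)
  have hbound : ∀ i, ∫⁻ t in Ioo a b, ‖G i t‖ₑ ≤ ENNReal.ofReal (M * m.factorial) := by
    intro i
    rw [← ofReal_integral_norm_eq_lintegral_enorm (hG i),
      setIntegral_congr_fun measurableSet_Ioo fun t ht => Real.norm_of_nonneg (hG0 i t ht)]
    refine ENNReal.ofReal_le_ofReal ?_
    rw [← div_le_iff₀ (by positivity), ← iterate_primitive_eq_setIntegral hg (hu i).2]
    exact (not_le.1 (hu i).1).le
  -- Fatou's lemma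
  refine integrable_of_tendsto (G := G) ?_ (fun i => (hG i).aestronglyMeasurable)
    (ne_top_of_le_ne_top ENNReal.ofReal_ne_top
      (liminf_le_of_frequently_le' (Frequently.of_forall hbound)))
  exact ae_restrict_of_forall_mem measurableSet_Ioo fun t ht =>
    (tendsto_indicator_pow_mul g m ht.2).comp hub

theorem exists_extension_Iio {F : ℝ → ℝ} {L : ℝ} (hF : ContinuousOn F (Iio b))
    (hL : Tendsto F (𝓝[<] b) (𝓝 L)) :
    ∃ H, Continuous H ∧ EqOn H F (Iio b) ∧ ∀ x ≥ b, H x = L := by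
  have hcont : ContinuousOn (Function.update F b L) (Iic b) := by
    rw [continuousOn_update_iff, Iic_sdiff_right]
    exact ⟨hF, fun _ => hL⟩
  refine ⟨fun x => Function.update F b L (min x b),
    hcont.comp_continuous (by fun_prop) fun x => min_le_right x b, fun x hx => ?_, fun x hx => ?_⟩
  · simp only [min_eq_left (mem_Iio.1 hx).le, Function.update_of_ne (ne_of_lt (mem_Iio.1 hx))]
  · simp only [min_eq_right hx, Function.update_self]

theorem exists_iteratedDeriv_eq {n : ℕ} {H : ℝ → ℝ} (hH : n ≠ 0 → Continuous H) :
    ∃ f, iteratedDeriv n f = H ∧ ∀ x, HasDerivOfOrder f n x := by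
  have h := fun x => hasDerivOfOrder_iterate_primitive (s := univ) (a := 0) isOpen_univ
    (fun hn => (hH hn).continuousOn) (mem_univ 0) (mem_univ x)
  exact ⟨(primitive 0)^[n] H, funext fun x => (h x).2, fun x => (h x).1⟩

theorem exists_iteratedDeriv_eq_primitive {n : ℕ} (hab : a < b)
    (hg : LocallyIntegrableOn g (Iio b))
    (hint : n ≠ 0 → IntegrableOn (fun t => (b - t) ^ m * g t) (Ioo a b)) :
    ∃ f, (∀ x < b, HasDerivOfOrder f (m + n) x ∧ iteratedDeriv (m + n) f x = primitive a g x) ∧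
      (∀ j, ∀ x > b, HasDerivOfOrder f j x) ∧ HasDerivOfOrder f n b := by
  have hF := continuousOn_iterate_primitive isOpen_Iio hg hab m
  -- `H` is to be the `n`-th derivative of `f`; it needs continuity at `b` unless `n = 0`.
  obtain ⟨H, L, hHc, hHF, hHL⟩ : ∃ H L, (n ≠ 0 → Continuous H) ∧
      EqOn H ((primitive a)^[m + 1] g) (Iio b) ∧ ∀ x > b, H x = L := by
    rcases eq_or_ne n 0 with hn | hn
    · refine ⟨(Iio b).indicator ((primitive a)^[m + 1] g), 0, fun h => (h hn).elim,
        fun x hx => indicator_of_mem hx _,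
        fun x hx => indicator_of_notMem (notMem_Iio.2 (le_of_lt hx)) _⟩
    · obtain ⟨L, hL⟩ := exists_tendsto_iterate_primitive hab (hg.mono_set Ico_subset_Iio_self)
        (hint hn)
      obtain ⟨H, hHc, hHF, hHL⟩ := exists_extension_Iio hF hL
      exact ⟨H, L, fun _ => hHc, hHF, fun x hx => hHL x hx.le⟩
  obtain ⟨f, hfH, hf⟩ := exists_iteratedDeriv_eq hHc
  have horder : ∀ {x j}, HasDerivOfOrder H j x → HasDerivOfOrder f (j + n) x := fun hHj => by
    rwa [← hasDerivOfOrder_iteratedDeriv_iff (Eventually.of_forall hf), hfH]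
  refine ⟨f, fun x hx => ?_, fun j x hx => ?_, hf b⟩
  · have hHx : H =ᶠ[𝓝 x] (primitive a)^[m + 1] g := eventually_of_mem (Iio_mem_nhds hx) hHF
    obtain ⟨h1, h2⟩ := hasDerivOfOrder_iterate_primitive (n := m) isOpen_Iio
      (fun _ => continuousOn_primitive isOpen_Iio hg hab) hab hx
    refine ⟨horder (h1.congr hHx), ?_⟩
    rw [← iteratedDeriv_iteratedDeriv, hfH, ← h2]
    exact Filter.EventuallyEq.iteratedDeriv_eq m hHx
  · exact (horder ((contDiff_const.hasDerivOfOrder j x).congr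
      (eventually_of_mem (Ioi_mem_nhds hx) hHL))).mono (j.le_add_right n)

end PrimitiveLimit

/-! ### Weighted integrability near an end point -/

section Weighted

variable {p α β : ℝ} {g : ℝ → ℝ} {t : ℝ} {m : ℕ}

theorem memLp_jacobi_iff (hp : 0 < p) (hg : Measurable g) :
    MemLp g (ENNReal.ofReal p) (jacobiMeasure α β) ↔
      IntegrableOn (fun t => (1 + t) ^ β * ((1 - t) ^ α * |g t| ^ p)) (Ioo (-1) 1) := by
  rw [← integrable_norm_rpow_iff hg.aestronglyMeasurable (by simpa using hp)
    ENNReal.ofReal_ne_top, ENNReal.toReal_ofReal hp.le, jacobiMeasure,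
    integrable_withDensity_iff_integrable_smul' (by fun_prop)
      (Eventually.of_forall fun _ => ENNReal.ofReal_lt_top),
    Measure.restrict_congr_set (Ioo_ae_eq_Icc (μ := volume) (a := (-1 : ℝ)) (b := 1)).symm]
  refine integrableOn_congr_fun (fun t ht => ?_) measurableSet_Ioo
  have h1 : 0 < 1 - t := by linarith [ht.2]
  have h2 : 0 < 1 + t := by linarith [ht.1]
  rw [smul_eq_mul, Real.norm_eq_abs, ENNReal.toReal_ofReal (by positivity)]
  ring

theorem integrableOn_Ioo_continuousOn_mul_iff {φ f : ℝ → ℝ} {a b : ℝ}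
    (hφ : ContinuousOn φ (Icc a b)) (hφ0 : ∀ t ∈ Icc a b, φ t ≠ 0) :
    IntegrableOn (fun t => φ t * f t) (Ioo a b) ↔ IntegrableOn f (Ioo a b) := by
  refine ⟨fun h => ?_, fun h =>
    h.continuousOn_mul_of_subset hφ isCompact_Icc measurableSet_Ioo Ioo_subset_Icc_self⟩
  refine (h.continuousOn_mul_of_subset (hφ.inv₀ hφ0) isCompact_Icc measurableSet_Ioo
    Ioo_subset_Icc_self).congr_fun (fun t ht => ?_) measurableSet_Ioo
  exact inv_mul_cancel_left₀ (hφ0 t (Ioo_subset_Icc_self ht)) (f t)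

theorem memLp_jacobi_iff_of_support_subset (hp : 0 < p) (hg : Measurable g)
    (hsupp : Function.support g ⊆ Ioo 0 1) :
    MemLp g (ENNReal.ofReal p) (jacobiMeasure α β) ↔
      IntegrableOn (fun t => (1 - t) ^ α * |g t| ^ p) (Ioo 0 1) := by
  have hcont : ContinuousOn (fun t : ℝ => (1 + t) ^ β) (Icc 0 1) := fun t ht =>
    (ContinuousAt.rpow_const (by fun_prop) (Or.inl (by linarith [ht.1]))).continuousWithinAt
  have hsupp' : (Function.support fun t => (1 + t) ^ β * ((1 - t) ^ α * |g t| ^ p)) ⊆ Ioo 0 1 :=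
    fun t ht => hsupp fun h0 => ht (by simp only [h0, abs_zero, Real.zero_rpow hp.ne', mul_zero])
  rw [memLp_jacobi_iff hp hg, integrableOn_iff_integrable_of_support_subset
      (hsupp'.trans (Ioo_subset_Ioo_left (by norm_num))),
    ← integrableOn_iff_integrable_of_support_subset hsupp']
  exact integrableOn_Ioo_continuousOn_mul_iff hcont fun t ht =>
    (Real.rpow_pos_of_pos (by linarith [ht.1]) β).ne'

theorem locallyIntegrableOn_of_abs_rpow {s : Set ℝ} (hp : 1 ≤ p) (hg : Measurable g)
    (h : LocallyIntegrableOn (fun t => |g t| ^ p) s) : LocallyIntegrableOn g s := by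
  refine ((locallyIntegrableOn_const 1).add h).mono hg.aestronglyMeasurable
    (Eventually.of_forall fun t => ?_)
  have h0 : 0 ≤ |g t| ^ p := by positivity
  rw [Real.norm_eq_abs, Pi.add_apply, Real.norm_of_nonneg (by positivity)]
  rcases le_total |g t| 1 with h1 | h1
  · linarith
  · linarith [Real.self_le_rpow_of_one_le h1 hp]

theorem locallyIntegrableOn_of_one_sub_rpow_mul (hp : 1 ≤ p) (hg : Measurable g)
    (hsupp : Function.support g ⊆ Ioo 0 1)
    (hint : IntegrableOn (fun t => (1 - t) ^ α * |g t| ^ p) (Ioo 0 1)) :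
    LocallyIntegrableOn g (Iio 1) := by
  have hsupp' : (Function.support fun t => (1 - t) ^ α * |g t| ^ p) ⊆ Ioo 0 1 := fun t ht =>
    hsupp fun h0 => ht (by simp only [h0, abs_zero, Real.zero_rpow (by linarith : p ≠ 0), mul_zero])
  have hcont : ContinuousOn (fun t : ℝ => (1 - t) ^ (-α)) (Iio 1) := fun t ht =>
    (ContinuousAt.rpow_const (by fun_prop) (Or.inl (sub_pos.2 ht).ne')).continuousWithinAt
  have hloc := (((integrableOn_iff_integrable_of_support_subset hsupp').1
    hint).locallyIntegrable.locallyIntegrableOn (Iio 1)).continuousOn_mul hcont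
    isOpen_Iio.isLocallyClosed
  refine locallyIntegrableOn_of_abs_rpow hp hg (hloc.congr ?_)
  refine ae_restrict_of_forall_mem measurableSet_Iio fun t ht => ?_
  have ht' : 0 < 1 - t := sub_pos.2 ht
  simp only
  rw [Real.rpow_neg ht'.le, inv_mul_cancel_left₀ (Real.rpow_pos_of_pos ht' α).ne']

/-- The inequality between `p`, `α` and `m` under which `(1 - t) ^ (m - 1) * g t` is integrable
near `1` for every `g` with `(1 - t) ^ α * |g t| ^ p` integrable. It is false for `p < 1`. -/
def EndpointInequality (p α : ℝ) (m : ℕ) : Prop :=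
  (1 < p ∧ α < m * p - 1) ∨ (p = 1 ∧ α ≤ m - 1)

theorem integrableOn_one_sub_rpow_iff {r : ℝ} :
    IntegrableOn (fun t : ℝ => (1 - t) ^ r) (Ioo 0 1) ↔ -1 < r := by
  rw [← intervalIntegral.integrableOn_Ioo_rpow_iff one_pos,
    ← (Measure.measurePreserving_sub_left volume (1 : ℝ)).integrableOn_comp_preimage
      (Homeomorph.subLeft (1 : ℝ)).measurableEmbedding]
  simp [Function.comp_def]

theorem memLp_one_sub_rpow_mul_iff {γ : ℝ} (hp : 0 < p) (hg : Measurable g) :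
    MemLp (fun t => (1 - t) ^ γ * g t) (ENNReal.ofReal p) (volume.restrict (Ioo 0 1)) ↔
      IntegrableOn (fun t => (1 - t) ^ (γ * p) * |g t| ^ p) (Ioo 0 1) := by
  rw [← integrable_norm_rpow_iff (Measurable.aestronglyMeasurable (by fun_prop))
    (by simpa using hp) ENNReal.ofReal_ne_top, ENNReal.toReal_ofReal hp.le]
  refine integrableOn_congr_fun (fun t ht => ?_) measurableSet_Ioo
  have h1 : 0 ≤ 1 - t := by linarith [ht.2]
  rw [norm_mul, Real.norm_of_nonneg (by positivity), Real.norm_eq_abs,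
    Real.mul_rpow (by positivity) (by positivity), ← Real.rpow_mul h1]

theorem integrableOn_pow_mul_of_lt (hp : 1 < p) (hα : α < (m + 1) * p - 1) (hg : Measurable g)
    (hint : IntegrableOn (fun t => (1 - t) ^ α * |g t| ^ p) (Ioo 0 1)) :
    IntegrableOn (fun t => (1 - t) ^ m * g t) (Ioo 0 1) := by
  have hp0 : 0 < p := one_pos.trans hp
  have hpq := Real.HolderConjugate.conjExponent hp
  have hr : -1 < (m - α / p) * p.conjExponent := by
    have h1 : (m - α / p) * p.conjExponent = (m * p - α) / (p - 1) := by
      rw [Real.conjExponent]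
      field_simp
    rw [h1, lt_div_iff₀ (sub_pos.2 hp)]
    linarith
  have hf : MemLp (fun t => (1 - t) ^ (α / p) * g t) (ENNReal.ofReal p)
      (volume.restrict (Ioo 0 1)) := by
    rwa [memLp_one_sub_rpow_mul_iff hp0 hg, div_mul_cancel₀ _ hp0.ne']
  have hw : MemLp (fun t : ℝ => (1 - t) ^ (m - α / p) * 1) (ENNReal.ofReal p.conjExponent)
      (volume.restrict (Ioo 0 1)) := by
    rw [memLp_one_sub_rpow_mul_iff hpq.symm.pos measurable_const]
    simpa only [abs_one, Real.one_rpow, mul_one] using integrableOn_one_sub_rpow_iff.2 hr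
  have := hpq.ennrealOfReal
  refine IntegrableOn.congr_fun (hw.integrable_mul hf) (fun t ht => ?_) measurableSet_Ioo
  have ht' : 0 < 1 - t := by linarith [ht.2]
  rw [Pi.mul_apply, mul_one, ← mul_assoc, ← Real.rpow_add ht', sub_add_cancel, Real.rpow_natCast]

theorem integrableOn_pow_mul_of_le (hα : α ≤ m) (hg : Measurable g)
    (hint : IntegrableOn (fun t => (1 - t) ^ α * |g t|) (Ioo 0 1)) :
    IntegrableOn (fun t => (1 - t) ^ m * g t) (Ioo 0 1) := by
  refine Integrable.mono' hint (Measurable.aestronglyMeasurable (by fun_prop))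
    (ae_restrict_of_forall_mem measurableSet_Ioo fun t ht => ?_)
  have h1 : 0 < 1 - t := by linarith [ht.2]
  rw [norm_mul, norm_pow, Real.norm_of_nonneg h1.le, Real.norm_eq_abs, ← Real.rpow_natCast]
  gcongr ?_ * _
  exact Real.rpow_le_rpow_of_exponent_ge h1 (by linarith [ht.1]) hα

theorem EndpointInequality.integrableOn_pow_mul (h : EndpointInequality p α (m + 1))
    (hg : Measurable g) (hint : IntegrableOn (fun t => (1 - t) ^ α * |g t| ^ p) (Ioo 0 1)) :
    IntegrableOn (fun t => (1 - t) ^ m * g t) (Ioo 0 1) := by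
  rcases h with ⟨hp, hα⟩ | ⟨rfl, hα⟩
  · exact integrableOn_pow_mul_of_lt hp (by exact_mod_cast hα) hg hint
  · simp only [Real.rpow_one] at hint
    exact integrableOn_pow_mul_of_le (by push_cast at hα; linarith) hg hint

theorem one_le_one_sub_log (ht : t ∈ Ioo 0 1) : 1 ≤ 1 - Real.log (1 - t) := by
  linarith [Real.log_nonpos (by linarith [ht.2] : 0 ≤ 1 - t) (by linarith [ht.1])]

theorem hasDerivAt_one_sub_log (ht : t < 1) :
    HasDerivAt (fun t => 1 - Real.log (1 - t)) (1 - t)⁻¹ t := by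
  have h := (((hasDerivAt_id' t).const_sub 1).log (sub_pos.2 ht).ne').const_sub 1
  rwa [neg_div, neg_neg, one_div] at h

theorem injOn_one_sub_log : InjOn (fun t => 1 - Real.log (1 - t)) (Ioo 0 1) := by
  intro s hs t ht hst
  have := Real.log_injOn_pos (mem_Ioi.2 (sub_pos.2 hs.2)) (mem_Ioi.2 (sub_pos.2 ht.2))
    (sub_right_injective hst)
  exact sub_right_injective this

theorem image_one_sub_log : (fun t => 1 - Real.log (1 - t)) '' Ioo 0 1 = Ioi 1 := by
  ext y
  constructor
  · rintro ⟨t, ht, rfl⟩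
    exact lt_sub_comm.1 ((Real.log_neg (sub_pos.2 ht.2) (sub_lt_self 1 ht.1)).trans_eq
      (sub_self 1).symm)
  · intro hy
    have hexp : Real.exp (1 - y) < 1 := Real.exp_lt_one_iff.2 (sub_neg.2 hy)
    exact ⟨1 - Real.exp (1 - y), ⟨sub_pos.2 hexp, sub_lt_self 1 (Real.exp_pos _)⟩, by simp⟩

theorem integrableOn_inv_mul_one_sub_log_rpow_iff {r : ℝ} :
    IntegrableOn (fun t => (1 - t)⁻¹ * (1 - Real.log (1 - t)) ^ r) (Ioo 0 1) ↔ r < -1 := by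
  rw [← integrableOn_Ioi_rpow_iff one_pos, ← image_one_sub_log,
    integrableOn_image_iff_integrableOn_abs_deriv_smul measurableSet_Ioo
      (fun t ht => (hasDerivAt_one_sub_log ht.2).hasDerivWithinAt) injOn_one_sub_log]
  refine integrableOn_congr_fun (fun t ht => ?_) measurableSet_Ioo
  rw [abs_of_pos (inv_pos.2 (sub_pos.2 ht.2)), smul_eq_mul]

theorem exists_not_integrableOn_pow_mul_of_lt (hα : m < α) :
    ∃ g : ℝ → ℝ, Measurable g ∧ (∀ t ∈ Ioo 0 1, 0 ≤ g t) ∧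
      IntegrableOn (fun t => (1 - t) ^ α * |g t|) (Ioo 0 1) ∧
      ¬ IntegrableOn (fun t => (1 - t) ^ m * g t) (Ioo 0 1) := by
  have hpos : ∀ t ∈ Ioo (0 : ℝ) 1, 0 < 1 - t := fun t ht => sub_pos.2 ht.2
  refine ⟨fun t => (1 - t) ^ (-(m + 1) : ℝ), by fun_prop,
    fun t ht => Real.rpow_nonneg (hpos t ht).le _, ?_, ?_⟩
  · refine (integrableOn_one_sub_rpow_iff.2 (by linarith : -1 < α - (m + 1))).congr_fun
      (fun t ht => ?_) measurableSet_Ioo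
    rw [abs_of_nonneg (Real.rpow_nonneg (hpos t ht).le _), ← Real.rpow_add (hpos t ht),
      sub_eq_add_neg]
  · rw [integrableOn_congr_fun (g := fun t => (1 - t) ^ (-1 : ℝ)) (fun t ht => ?_)
      measurableSet_Ioo, integrableOn_one_sub_rpow_iff]
    · exact lt_irrefl _
    · rw [← Real.rpow_natCast, ← Real.rpow_add (hpos t ht)]
      ring_nf

theorem exists_not_integrableOn_pow_mul_of_le (hp : 1 < p) (hα : (m + 1) * p - 1 ≤ α) :
    ∃ g : ℝ → ℝ, Measurable g ∧ (∀ t ∈ Ioo 0 1, 0 ≤ g t) ∧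
      IntegrableOn (fun t => (1 - t) ^ α * |g t| ^ p) (Ioo 0 1) ∧
      ¬ IntegrableOn (fun t => (1 - t) ^ m * g t) (Ioo 0 1) := by
  have hpos : ∀ t ∈ Ioo (0 : ℝ) 1, 0 < 1 - t := fun t ht => sub_pos.2 ht.2
  have hlog : ∀ t ∈ Ioo (0 : ℝ) 1, 0 < 1 - Real.log (1 - t) := fun t ht =>
    one_pos.trans_le (one_le_one_sub_log ht)
  have hnonneg : ∀ t ∈ Ioo (0 : ℝ) 1,
      0 ≤ (1 - t) ^ (-(m + 1) : ℝ) * (1 - Real.log (1 - t)) ^ (-1 : ℝ) := fun t ht =>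
    mul_nonneg (Real.rpow_nonneg (hpos t ht).le _) (Real.rpow_nonneg (hlog t ht).le _)
  refine ⟨fun t => (1 - t) ^ (-(m + 1) : ℝ) * (1 - Real.log (1 - t)) ^ (-1 : ℝ), by fun_prop,
    hnonneg, ?_, ?_⟩
  · refine Integrable.mono' (integrableOn_inv_mul_one_sub_log_rpow_iff.2 (neg_lt_neg hp))
      (Measurable.aestronglyMeasurable (by fun_prop))
      (ae_restrict_of_forall_mem measurableSet_Ioo fun t ht => ?_)
    have ht0 := hpos t ht
    have hlog0 := hlog t ht
    rw [Real.norm_of_nonneg (by positivity), abs_of_nonneg (hnonneg t ht),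
      Real.mul_rpow (by positivity) (by positivity), ← Real.rpow_mul ht0.le,
      ← Real.rpow_mul hlog0.le, neg_one_mul, ← mul_assoc, ← Real.rpow_add ht0,
      ← Real.rpow_neg_one (1 - t)]
    gcongr ?_ * _
    exact Real.rpow_le_rpow_of_exponent_ge ht0 (by linarith [ht.1]) (by linarith)
  · rw [integrableOn_congr_fun (g := fun t => (1 - t)⁻¹ * (1 - Real.log (1 - t)) ^ (-1 : ℝ))
      (fun t ht => ?_) measurableSet_Ioo, integrableOn_inv_mul_one_sub_log_rpow_iff]
    · exact lt_irrefl _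
    · simp only
      rw [← mul_assoc, ← Real.rpow_natCast, ← Real.rpow_add (hpos t ht),
        ← Real.rpow_neg_one (1 - t)]
      ring_nf

theorem exists_not_integrableOn_pow_mul (hp : 1 ≤ p) (h : ¬ EndpointInequality p α (m + 1)) :
    ∃ g : ℝ → ℝ, Measurable g ∧ (∀ t ∈ Ioo 0 1, 0 ≤ g t) ∧
      IntegrableOn (fun t => (1 - t) ^ α * |g t| ^ p) (Ioo 0 1) ∧
      ¬ IntegrableOn (fun t => (1 - t) ^ m * g t) (Ioo 0 1) := by
  rw [EndpointInequality, not_or, not_and, not_and] at h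
  rcases hp.eq_or_lt with rfl | hp
  · have hα : m < α := by simpa using h.2 rfl
    simpa only [Real.rpow_one] using exists_not_integrableOn_pow_mul_of_lt hα
  · exact exists_not_integrableOn_pow_mul_of_le hp (by exact_mod_cast not_lt.1 (h.1 hp))

end Weighted

/-! ### The conditions at the end points -/

section Endpoint

variable {p α β : ℝ} {ℓ : ℕ} {ω : Fin ℓ → ℝ} {f g : ℝ → ℝ} {m : ℕ}

/-- The restriction that the points of `ω` equal to `1` impose on `p` and `α` when `U` is complete.
The value `f (ω 0)` requires no differentiability, so the index `0` is exempt. -/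
def EndpointCondition (p α : ℝ) {ℓ : ℕ} (ω : Fin ℓ → ℝ) : Prop :=
  ∀ k : Fin ℓ, (k : ℕ) ≠ 0 → ω k = 1 → EndpointInequality p α (ℓ - k)

theorem EndpointCondition.exists_order (h : EndpointCondition p α ω) (hℓ : 0 < ℓ) :
    ∃ n < ℓ, (∀ k, ω k = 1 → (k : ℕ) ≤ n) ∧ (n ≠ 0 → EndpointInequality p α (ℓ - n)) := by
  set s := Finset.univ.filter fun k => ω k = 1
  have hs : ∀ {k}, k ∈ s ↔ ω k = 1 := by simp [s]
  refine ⟨s.sup (fun k : Fin ℓ => (k : ℕ)), (Finset.sup_lt_iff hℓ).2 fun k _ => k.2,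
    fun k hk => Finset.le_sup (f := fun k : Fin ℓ => (k : ℕ)) (hs.2 hk), fun hn => ?_⟩
  have hne : s.Nonempty := Finset.nonempty_iff_ne_empty.2 fun h0 =>
    hn (by rw [h0, Finset.sup_empty, bot_eq_zero'])
  obtain ⟨k, hk, hkn⟩ := Finset.exists_mem_eq_sup s hne fun k : Fin ℓ => (k : ℕ)
  rw [hkn] at hn ⊢
  exact h k hn (hs.1 hk)

theorem isTopDeriv_of_iteratedDeriv_eq_primitive (hℓ : ℓ ≠ 0)
    (hg : MemLp g (ENNReal.ofReal p) (jacobiMeasure α β))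
    (hloc : LocallyIntegrableOn g (Ioo (-1) 1)) (hω : ∀ k : Fin ℓ, HasDerivOfOrder f k (ω k))
    (hf : ∀ x ∈ Ioo (-1) 1,
      HasDerivOfOrder f (ℓ - 1) x ∧ iteratedDeriv (ℓ - 1) f x = primitive 0 g x) :
    IsTopDeriv p α β ω g := by
  have h0 : (0 : ℝ) ∈ Ioo (-1) 1 := by norm_num
  have hae : iteratedDeriv ℓ f =ᵐ[jacobiMeasure α β] g := by
    refine ae_jacobi_of_ae ?_
    filter_upwards [ae_hasDerivAt_primitive isOpen_Ioo hloc h0] with x hx hxI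
    rw [← Nat.sub_one_add_one hℓ, iteratedDeriv_succ]
    refine ((hx hxI).congr_of_eventuallyEq ?_).deriv
    exact eventually_of_mem (isOpen_Ioo.mem_nhds hxI) fun y hy => (hf y hy).2
  refine ⟨f, ⟨hω, fun x hx => (hf x hx).1, fun a b ha hab hb => ?_, (memLp_congr_ae hae).2 hg⟩, hae⟩
  have haI : a ∈ Ioo (-1) 1 := ⟨ha, hab.trans_lt hb⟩
  have hbI : b ∈ Ioo (-1) 1 := ⟨ha.trans_le hab, hb⟩
  exact (absolutelyContinuousOnInterval_congr fun x hx =>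
    (hf x (ordConnected_Ioo.uIcc_subset haI hbI hx)).2).2
    (absolutelyContinuousOnInterval_primitive hloc h0 haI hbI)

theorem EndpointCondition.isTopDeriv_of_support_subset (h : EndpointCondition p α ω) (hℓ : ℓ ≠ 0)
    (hp : 1 ≤ p) (hgm : Measurable g) (hsupp : Function.support g ⊆ Ioo 0 1)
    (hg : MemLp g (ENNReal.ofReal p) (jacobiMeasure α β)) : IsTopDeriv p α β ω g := by
  obtain ⟨n, hnℓ, hωn, hn⟩ := h.exists_order (Nat.pos_of_ne_zero hℓ)
  obtain ⟨m, rfl⟩ : ∃ m, ℓ = m + n + 1 := ⟨ℓ - n - 1, by omega⟩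
  rw [show m + n + 1 - n = m + 1 by omega] at hn
  have hw := (memLp_jacobi_iff_of_support_subset (one_pos.trans_le hp) hgm hsupp).1 hg
  have hloc := locallyIntegrableOn_of_one_sub_rpow_mul hp hgm hsupp hw
  obtain ⟨f, hlt, hgt, h1⟩ := exists_iteratedDeriv_eq_primitive one_pos hloc
    fun h0 => (hn h0).integrableOn_pow_mul hgm hw
  refine isTopDeriv_of_iteratedDeriv_eq_primitive hℓ hg (hloc.mono_set Ioo_subset_Iio_self)
    (fun k => ?_) fun x hx => hlt x hx.2
  rcases lt_trichotomy (ω k) 1 with hk | hk | hk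
  · exact (hlt _ hk).1.mono (by omega)
  · rw [hk]
    exact h1.mono (hωn k hk)
  · exact hgt k _ hk

theorem indicator_add_indicator_neg (g : ℝ → ℝ) {x : ℝ} (hx : x ∈ Ioo (-1) 1) (hx0 : x ≠ 0) :
    (Ioo 0 1).indicator g x + (Ioo 0 1).indicator (fun y => g (-y)) (-x) = g x := by
  rcases lt_or_gt_of_ne hx0 with h | h
  · rw [indicator_of_notMem fun h' => h.not_gt h'.1,
      indicator_of_mem (mem_Ioo.2 ⟨neg_pos.2 h, neg_lt.1 hx.1⟩), neg_neg, zero_add]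
  · rw [indicator_of_mem (mem_Ioo.2 ⟨h, hx.2⟩),
      indicator_of_notMem fun h' => h.not_gt (neg_pos.1 h'.1), add_zero]

theorem EndpointCondition.isTopDeriv (h1 : EndpointCondition p α ω)
    (h2 : EndpointCondition p β (-ω)) (hℓ : ℓ ≠ 0) (hp : 1 ≤ p)
    (hg : MemLp g (ENNReal.ofReal p) (jacobiMeasure α β)) : IsTopDeriv p α β ω g := by
  obtain ⟨g', hg'm, hgg'⟩ := hg.1
  have hg' := (memLp_congr_ae hgg').1 hg
  set u := (Ioo 0 1).indicator g'
  set v := (Ioo 0 1).indicator fun y => g' (-y)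
  have hvm : Measurable v := (hg'm.measurable.comp measurable_neg).indicator measurableSet_Ioo
  have hu : IsTopDeriv p α β ω u :=
    h1.isTopDeriv_of_support_subset hℓ hp (hg'm.measurable.indicator measurableSet_Ioo)
      support_indicator_subset (hg'.indicator measurableSet_Ioo)
  have hv : IsTopDeriv p β α (-ω) fun x => (-1) ^ ℓ * v x :=
    h2.isTopDeriv_of_support_subset hℓ hp (hvm.const_mul _)
      ((Function.support_mul_subset_right _ _).trans support_indicator_subset)
      (((memLp_jacobi_comp_neg hg').indicator measurableSet_Ioo).const_mul _)
  have hv' := hv.comp_neg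
  rw [neg_neg] at hv'
  refine (hu.add hv').congr_ae (EventuallyEq.trans ?_ hgg'.symm)
  refine ae_jacobi_of_ae ?_
  filter_upwards [Measure.ae_ne volume 0] with x hx0 hx
  exact indicator_add_indicator_neg g' hx hx0

theorem ae_of_ae_jacobi {q : ℝ → Prop} (h : ∀ᵐ x ∂(jacobiMeasure α β), q x) :
    ∀ᵐ x ∂volume, x ∈ Ioo (-1) 1 → q x := by
  rw [jacobiMeasure, ae_withDensity_iff (by fun_prop),
    Measure.restrict_congr_set (Ioo_ae_eq_Icc (μ := volume) (a := (-1 : ℝ)) (b := 1)).symm,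
    ae_restrict_iff' measurableSet_Ioo] at h
  filter_upwards [h] with x hx hx1
  refine hx hx1 (ENNReal.ofReal_pos.2 ?_).ne'
  have h1 : 0 < 1 - x := by linarith [hx1.2]
  have h2 : 0 < 1 + x := by linarith [hx1.1]
  positivity

theorem IsSobolev.iteratedDeriv_sub_one_eq (hℓ : ℓ ≠ 0) (hf : IsSobolev p α β ω f)
    (hfg : iteratedDeriv ℓ f =ᵐ[jacobiMeasure α β] g) {x : ℝ} (hx : x ∈ Ioo (-1) 1) :
    iteratedDeriv (ℓ - 1) f x = iteratedDeriv (ℓ - 1) f 0 + primitive 0 g x := by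
  have h0 : (0 : ℝ) ∈ Ioo (-1) 1 := by norm_num
  have hac : AbsolutelyContinuousOnInterval (iteratedDeriv (ℓ - 1) f) 0 x := by
    refine (hf.absCont (min 0 x) (max 0 x) (lt_min h0.1 hx.1) min_le_max
      (max_lt h0.2 hx.2)).mono ?_
    rw [uIcc_of_le min_le_max]
    rfl
  have hderiv : ∫ t in (0 : ℝ)..x, deriv (iteratedDeriv (ℓ - 1) f) t = primitive 0 g x := by
    refine intervalIntegral.integral_congr_ae ?_
    filter_upwards [ae_of_ae_jacobi hfg] with t ht ht'
    rw [← iteratedDeriv_succ, Nat.sub_one_add_one hℓ]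
    exact ht (ordConnected_Ioo.uIcc_subset h0 hx (uIoc_subset_uIcc ht'))
  rw [← hderiv, hac.integral_deriv_eq_sub, add_sub_cancel]

theorem IsSobolev.isBounded_iteratedDeriv_sub_primitive (hf : IsSobolev p α β ω f)
    (hfg : iteratedDeriv ℓ f =ᵐ[jacobiMeasure α β] g) (hloc : LocallyIntegrableOn g (Ioo (-1) 1))
    {k : ℕ} (hℓ : ℓ = m + k + 1) :
    Bornology.IsBounded
      (((1 : ℝ) • iteratedDeriv k f + (-1 : ℝ) • (primitive 0)^[m + 1] g) '' Ioo (-1) 1) := by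
  have h0 : (0 : ℝ) ∈ Ioo (-1) 1 := by norm_num
  have hfk : ∀ x ∈ Ioo (-1 : ℝ) 1, HasDerivOfOrder (iteratedDeriv k f) m x := fun x hx => by
    rw [hasDerivOfOrder_iteratedDeriv_iff (eventually_of_mem (isOpen_Ioo.mem_nhds hx)
      fun y hy => (hf.deriv_on y hy).mono (by omega))]
    exact (hf.deriv_on x hx).mono (by omega)
  have hprim := fun x (hx : x ∈ Ioo (-1 : ℝ) 1) => hasDerivOfOrder_iterate_primitive (n := m)
    isOpen_Ioo (fun _ => continuousOn_primitive isOpen_Ioo hloc h0) h0 hx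
  have hcomb := fun x (hx : x ∈ Ioo (-1 : ℝ) 1) => (hfk x hx).comb 1 (-1) (hprim x hx).1
  refine HasDerivOfOrder.isBounded_image (convex_Ioo _ _) (Metric.isBounded_Ioo _ _)
    (fun x hx => (hcomb x hx).1)
    ((Bornology.isBounded_singleton (x := iteratedDeriv (ℓ - 1) f 0)).subset ?_)
  rintro _ ⟨x, hx, rfl⟩
  have hx' := hf.iteratedDeriv_sub_one_eq (by omega) hfg hx
  rw [show ℓ - 1 = m + k by omega] at hx' ⊢
  rw [mem_singleton_iff]
  refine (hcomb x hx).2.trans ?_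
  rw [iteratedDeriv_iteratedDeriv, (hprim x hx).2, hx']
  ring

theorem integrableOn_pow_mul_of_isTopDeriv {k : Fin ℓ} (hk : (k : ℕ) ≠ 0) (hω : ω k = 1)
    (hℓ : ℓ = m + k + 1) (hloc : LocallyIntegrableOn g (Iio 1)) (hg0 : ∀ t ∈ Ioo 0 1, 0 ≤ g t)
    (h : IsTopDeriv p α β ω g) : IntegrableOn (fun t => (1 - t) ^ m * g t) (Ioo 0 1) := by
  by_contra hint
  obtain ⟨f, hf, hfg⟩ := h
  obtain ⟨C, hC⟩ := (hf.isBounded_iteratedDeriv_sub_primitive hfg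
    (hloc.mono_set Ioo_subset_Iio_self) hℓ).exists_norm_le
  have htop : Tendsto (iteratedDeriv k f) (𝓝[<] 1) atTop := by
    refine tendsto_atTop_mono' _ ?_ (tendsto_atTop_add_const_right _ (-C)
      (tendsto_iterate_primitive_atTop one_pos (hloc.mono_set Ico_subset_Iio_self) hg0 hint))
    filter_upwards [Ioo_mem_nhdsLT (by norm_num : (-1 : ℝ) < 1)] with x hx
    have hx' := (abs_le.1 (hC _ (mem_image_of_mem _ hx))).1
    simp only [Pi.add_apply, Pi.smul_apply, smul_eq_mul] at hx'
    linarith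
  have hdiff : DifferentiableAt ℝ (iteratedDeriv (k - 1) f) 1 :=
    hω ▸ ((hf.deriv_at k).hasDerivAt (by omega)).differentiableAt
  rw [← Nat.sub_one_add_one hk, iteratedDeriv_succ] at htop
  exact not_differentiableWithinAt_of_deriv_tendsto_atTop_Iio _ htop hdiff.differentiableWithinAt

theorem endpointCondition_of_isTopDeriv (hp : 1 ≤ p)
    (h : ∀ g, MemLp g (ENNReal.ofReal p) (jacobiMeasure α β) → IsTopDeriv p α β ω g) :
    EndpointCondition p α ω := by
  intro k hk hω
  obtain ⟨m, hℓ⟩ : ∃ m, ℓ = m + k + 1 := ⟨ℓ - k - 1, by omega⟩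
  rw [show ℓ - (k : ℕ) = m + 1 by omega]
  by_contra hcon
  obtain ⟨g, hgm, hg0, hint, hnot⟩ := exists_not_integrableOn_pow_mul hp hcon
  set u := (Ioo 0 1).indicator g
  have hug : EqOn u g (Ioo 0 1) := fun t ht => indicator_of_mem ht g
  have hum : Measurable u := hgm.indicator measurableSet_Ioo
  have husupp : Function.support u ⊆ Ioo 0 1 := support_indicator_subset
  have hu : IntegrableOn (fun t => (1 - t) ^ α * |u t| ^ p) (Ioo 0 1) :=
    hint.congr_fun (fun t ht => by rw [hug ht]) measurableSet_Ioo
  refine hnot ((integrableOn_pow_mul_of_isTopDeriv hk hω hℓ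
    (locallyIntegrableOn_of_one_sub_rpow_mul hp hum husupp hu)
    (fun t ht => (hg0 t ht).trans_eq (hug ht).symm) (h u ?_)).congr_fun
    (fun t ht => by simp only [hug ht]) measurableSet_Ioo)
  exact (memLp_jacobi_iff_of_support_subset (one_pos.trans_le hp) hum husupp).2 hu

theorem forall_isTopDeriv_iff (hℓ : ℓ ≠ 0) (hp : 1 ≤ p) :
    (∀ g, MemLp g (ENNReal.ofReal p) (jacobiMeasure α β) → IsTopDeriv p α β ω g) ↔
      EndpointCondition p α ω ∧ EndpointCondition p β (-ω) := by
  refine ⟨fun h => ⟨endpointCondition_of_isTopDeriv hp h,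
    endpointCondition_of_isTopDeriv (β := α) hp fun g hg => ?_⟩,
    fun h g hg => h.1.isTopDeriv h.2 hℓ hp hg⟩
  simpa only [neg_neg] using
    (h _ ((memLp_jacobi_comp_neg hg).const_mul ((-1) ^ ℓ))).comp_neg (g := fun x => g (-x))

theorem endpointInequality_iff_of_one_lt (hp : 1 < p) (m : ℕ) :
    EndpointInequality p α m ↔ α < m * p - 1 := by
  simp only [EndpointInequality, hp, hp.ne', true_and, false_and, or_false]

theorem endpointInequality_one_iff (m : ℕ) : EndpointInequality 1 α m ↔ α ≤ m - 1 := by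
  simp only [EndpointInequality, lt_irrefl, true_and, false_and, false_or]

theorem endpointCondition_iff :
    EndpointCondition p α ω ↔ ∀ (m : ℕ) (hm1 : 1 ≤ m) (hm2 : m ≤ ℓ - 1),
      ¬ EndpointInequality p α m → ω ⟨ℓ - m, by omega⟩ ≠ 1 := by
  refine ⟨fun h m hm1 hm2 hm => mt (h ⟨ℓ - m, by omega⟩ ?_) ?_, fun h k hk => ?_⟩
  · exact (Nat.sub_pos_of_lt (by omega)).ne'
  · rwa [Nat.sub_sub_self (by omega)]
  · have hk' : (⟨ℓ - (ℓ - k), by omega⟩ : Fin ℓ) = k := Fin.ext (Nat.sub_sub_self k.2.le)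
    have hωk := h (ℓ - k) (by omega) (by omega)
    rw [hk'] at hωk
    exact fun hω => by_contra fun hm => hωk hm hω

theorem endpointCondition_fin_one (ω : Fin 1 → ℝ) : EndpointCondition p α ω :=
  fun k hk => (hk (Fin.val_eq_zero k)).elim

end Endpoint
end JacobiSobolev
end

theorem mainTheorem2 {ℓ : ℕ} (hℓ : 1 ≤ ℓ) (p α β : ℝ)
    [Fact (1 ≤ p)] [Fact (-1 < α)] [Fact (-1 < β)] (ω : Fin ℓ → ℝ) :
    (CompleteSpace (JacobiSobolev.U p α β ω) ↔
      (ℓ = 1 ∨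
        (2 ≤ ℓ ∧ 1 < p ∧ ∀ (m : ℕ) (hm1 : 1 ≤ m) (hm2 : m ≤ ℓ - 1),
          ((m : ℝ) * p - 1 ≤ α → ω ⟨ℓ - m, by omega⟩ ≠ 1) ∧
          ((m : ℝ) * p - 1 ≤ β → ω ⟨ℓ - m, by omega⟩ ≠ -1)) ∨
        (2 ≤ ℓ ∧ p = 1 ∧ ∀ (m : ℕ) (hm1 : 1 ≤ m) (hm2 : m ≤ ℓ - 1),
          ((m : ℝ) - 1 < α → ω ⟨ℓ - m, by omega⟩ ≠ 1) ∧
          ((m : ℝ) - 1 < β → ω ⟨ℓ - m, by omega⟩ ≠ -1)))) ∧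
    (CompleteSpace (JacobiSobolev.U p α β ω) →
      ∃ e : JacobiSobolev.U p α β ω ≃ₗᵢ[ℝ] JacobiSobolev.W p α β ω,
        ∀ P : JacobiSobolev.SobolevPoly p α β ω, e (JacobiSobolev.polyU P) = JacobiSobolev.polyW P) := by
  have hp : 1 ≤ p := Fact.out
  refine ⟨?_, fun _ => JacobiSobolev.exists_linearIsometryEquiv_of_completeSpace⟩
  rw [JacobiSobolev.completeSpace_U_iff, JacobiSobolev.forall_isTopDeriv_iff (by omega) hp]
  rcases hℓ.eq_or_lt with rfl | hℓ2
  · exact ⟨fun _ => Or.inl rfl, fun _ =>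
      ⟨JacobiSobolev.endpointCondition_fin_one _, JacobiSobolev.endpointCondition_fin_one _⟩⟩
  have hℓ2' : 2 ≤ ℓ := hℓ2
  simp only [JacobiSobolev.endpointCondition_iff, Pi.neg_apply, ne_eq, neg_eq_iff_eq_neg,
    ← forall_and, hℓ2.ne', hℓ2', true_and, false_or]
  rcases hp.eq_or_lt with rfl | hp1
  · simp only [JacobiSobolev.endpointInequality_one_iff, not_le, lt_irrefl, false_and, true_and,
      false_or]
  · simp only [JacobiSobolev.endpointInequality_iff_of_one_lt hp1, not_lt, hp1, hp1.ne', true_and,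
      false_and, or_false]
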